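/- Let $\mathbb G$ be a Carnot group of step $s$, i.e. a connected and simply connected Lie group whose Lie algebra has a stratification $\mathfrak g=V_1\oplus\dots\oplus V_s$, $[V_1,V_j]=V_{j+1}$ for $1\le j<s$, $[V_1,V_s]=0$; identify $\mathbb G$ with $\mathfrak g$ through $\exp$, and let $\delta_r$ be the dilations ($\delta_r=r^j$ on $V_j$). Let $(X_1,\dots,X_n)$ be a basis of $\mathfrak g$ adapted to the stratification (ordered by layers, the $X_i$ of degree $\deg i=j$ forming a basis of $V_j$), $m=\dim V_1$, and let $\mathbb L=\exp(\mathrm{span}\{X_1,\dots,X_k\})$ with $k\le m$ and $\mathbb W=\exp(\mathrm{span}\{X_{k+1},\dots,X_n\})$ be complementary homogeneous subgroups: $\mathbb G=\mathbb W\cdot\mathbb L$, $\mathbb W\cap\mathbb L=\{e\}$, with projections $\pi_{\mathbb W},\pi_{\mathbb L}$ (so $\mathbb L$ is horizontal and $k$-dimensional). Fix a continuous homogeneous norm $\|\cdot\|$ (nonnegative, zero only at $e$, $\|\delta_r g\|=r\|g\|$, $\|g^{-1}\|=\|g\|$) and a continuous left-invariant homogeneous distance $d$, with balls $B(g,r)$.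 Let $U\subseteq\mathbb W$ be open and let $\phi:U\to\mathbb L$ be continuous, with coordinates $\phi^{(1)},\dots,\phi^{(k)}$. For $j>k$ let $D^\phi_j$ be the vector field on $U$ given by $D^\phi_j(w)=d(\pi_{\mathbb W})_{w\phi(w)}\big(X_j|_{w\phi(w)}\big)$, $X_j$ being regarded as a left-invariant field. * $\phi$ is *vertically broad\* hölder* if for every $a_0\in U$ there are $\delta>0$ and neighborhoods $U'\Subset U''\Subset U$ of $a_0$ and, for all $a\in U'$ and $j>m$, a $C^1$ solution $E_j(a,\cdot):[-\delta,\delta]\to U''$ of $\dot\gamma=D^\phi_j\circ\gamma$, $\gamma(0)=a$, such that $$\lim_{\varrho\to0}\ \sup\Big\{\tfrac{|\phi(E_j(a,t))-\phi(E_j(a,t'))|}{|t-t'|^{1/\deg j}}:\ j>m,\ a\in U',\ 0<|t-t'|\le\varrho\Big\}=0 .$$ * For a continuous $\omega=(\omega_{\ell j}):U\to\mathbb R^{k\times(m-k)}$ ($1\le\ell\le k<j\le m$), *$D^\phi\phi=\omega$ in the broad\* sense on $U$* means: for every $a_0\in U$ there are $0<\delta_2<\delta_1$ and maps $E_j:(\overline{B(a_0,\delta_2)}\cap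 U)\times[-\delta_2,\delta_2]\to\overline{B(a_0,\delta_1)}\cap U$, $k<j\le m$, such that each $E_j(a,\cdot)$ is a $C^1$ solution of $\dot\gamma=D^\phi_j\circ\gamma$, $\gamma(0)=a$, and $\phi^{(\ell)}(E_j(a,t))-\phi^{(\ell)}(a)=\int_0^t\omega_{\ell j}(E_j(a,r))\,dr$ for all $\ell,j,a,t$. A map $\lambda:\mathbb W\to\mathbb L$ is *intrinsically linear* if $\{w\lambda(w):w\in\mathbb W\}$ is a homogeneous subgroup. For $q\in\mathbb G$ put $U_q=\{b\in\mathbb W:\pi_{\mathbb W}(q^{-1}b)\in U\}$, $\phi_q(b)=\pi_{\mathbb L}(q^{-1}b)^{-1}\phi(\pi_{\mathbb W}(q^{-1}b))$, and for $a\in U$ put $p_a=\phi(a)^{-1}a^{-1}$. An intrinsically linear $\lambda$ is an *intrinsic differential* of $\phi$ at $a_0\in U$ if $\|\lambda(b)^{-1}\phi_{p_{a_0}}(b)\|/\|b\|\to0$ as $\|b\|\to0$, $b\in U_{p_{a_0}}\setminus\{e\}$. The function $\phi$ is *uniformly intrinsically differentiable* at $a_0$ if it has an intrinsic differential $\lambda$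 at $a_0$ with $$\lim_{r\to0}\ \sup\Big\{\tfrac{\|\lambda(b)^{-1}\phi_{p_a}(b)\|}{\|b\|}:\ a\in U\cap B(a_0,r),\ b\in U_{p_a}\cap B(e,r),\ b\ne e\Big\}=0 .$$ The *intrinsic gradient* $\nabla^\phi\phi_{a_0}$ is the $k\times(m-k)$ matrix of the linear map $\mathrm{Lie}(\mathbb W)\cap V_1\to\mathrm{Lie}(\mathbb L)$ with $\lambda(\exp Y)=\exp(\nabla^\phi\phi_{a_0}Y)$ for all $Y\in\mathrm{Lie}(\mathbb W)\cap V_1$, where $\lambda$ is the intrinsic differential of $\phi$ at $a_0$. **Proposition.** If $\phi$ is vertically broad\* hölder and $D^\phi\phi=\omega$ in the broad\* sense on $U$ for a continuous $\omega:U\to\mathbb R^{k\times(m-k)}$, then $\phi$ is uniformly intrinsically differentiable at every point of $U$, and $\nabla^\phi\phi=\omega$ on $U$. -/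

import Mathlib

open Set Filter Topology
open scoped Manifold

namespace Carnot

noncomputable section

/-! ### Carnot groups

A Carnot group is presented through its exponential map: the manifold underlying the Lie group is
its Lie algebra `G` (a finite-dimensional real vector space), and `exp` is the identity map.
The group operation is written multiplicatively; it is different from the vector addition of `G`,
and the identity element `1` is the vector `0`. The Lie bracket is the one on the tangent space at `1`
given by brackets of left-invariant vector fields. -/

section Group

variable {G : Type*} [NormedAddCommGroup G] [NormedSpace ℝ G] [Group G]

/-- The value at `g` of the left-invariant vector field with value `x` at the identity: the
differential at `1` of the left translation by `g`, applied to `x`. -/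
def leftInvariant (x g : G) : G := fderiv ℝ (fun p : G => g * p) 1 x

/-- The Lie bracket `[x, y]` of two elements of the Lie algebra (the tangent space of `G` at `1`,
which is `G` itself): the value at `1` of the bracket of the associated left-invariant fields. -/
def lieBracket (x y : G) : G := VectorField.lieBracket ℝ (leftInvariant x) (leftInvariant y) 1

/-- This is the bracket of Mathlib's Lie algebra `GroupLieAlgebra 𝓘(ℝ, G) G`. -/
theorem lieBracket_eq_groupLieAlgebra (x y : G) :
    lieBracket x y = Bracket.bracket (L := GroupLieAlgebra 𝓘(ℝ, G) G)
      (M := GroupLieAlgebra 𝓘(ℝ, G) G) x y := by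
  have e : ∀ z : G, (mulInvariantVectorField (I := 𝓘(ℝ, G)) (G := G) z : G → G) =
      leftInvariant z := fun z => by
    funext g
    exact congrArg (fun f : G →L[ℝ] G => f z) (mfderiv_eq_fderiv (f := fun p : G => g * p) (x := 1))
  refine Eq.trans ?_ (GroupLieAlgebra.bracket_def (I := 𝓘(ℝ, G)) (G := G) x y).symm
  rw [← VectorField.mlieBracketWithin_univ, VectorField.mlieBracketWithin_eq_lieBracketWithin]
  refine Eq.trans ?_ (congrFun VectorField.lieBracketWithin_univ 1).symm
  exact congrArg₂ (fun v w : G → G => VectorField.lieBracket ℝ v w 1) (e x).symm (e y).symm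

/-- `G` is a Carnot group of step `s` with layers `V 1, …, V s`, in exponential coordinates
(the values of `V` outside `{1, …, s}` are irrelevant).
`exp_add` says that `t ↦ t • x`, the curve through `1` with velocity `x`, is a one-parameter
subgroup for every `x`, that is, the exponential map is the identity. -/
structure IsCarnotGroup [LieGroup 𝓘(ℝ, G) ((⊤ : ℕ∞) : WithTop ℕ∞) G] (s : ℕ)
    (V : ℕ → Submodule ℝ G) : Prop where
  exp_add : ∀ (a b : ℝ) (x : G), (a + b) • x = (a • x) * (b • x)
  directSum : DirectSum.IsInternal (fun i : Finset.Icc 1 s => V i)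
  bracket_layer : ∀ j, 1 ≤ j → j < s →
    Submodule.span ℝ {z : G | ∃ x ∈ V 1, ∃ y ∈ V j, z = lieBracket x y} = V (j + 1)
  bracket_last : ∀ x ∈ V 1, ∀ y ∈ V s, lieBracket x y = 0

variable {n : ℕ}

/-- `X` is a basis of the Lie algebra adapted to the layers `V 1, …, V s`, ordered by
increasing layers; `deg i` is the holonomic degree of `X i`. -/
structure IsAdaptedBasis (s : ℕ) (V : ℕ → Submodule ℝ G) (X : Module.Basis (Fin n) ℝ G)
    (deg : Fin n → ℕ) : Prop where
  deg_mem : ∀ i, deg i ∈ Finset.Icc 1 s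
  deg_mono : Monotone deg
  span_layer : ∀ j ∈ Finset.Icc 1 s, Submodule.span ℝ (X '' {i | deg i = j}) = V j

variable (X : Module.Basis (Fin n) ℝ G) (deg : Fin n → ℕ)

/-- The dilation `δ_r`: multiplication by `r ^ j` on the `j`-th layer. -/
def dilation (r : ℝ) (x : G) : G := ∑ i, (r ^ deg i * X.repr x i) • X i

/-- A homogeneous norm on `G`. -/
structure IsHomogeneousNorm (N : G → ℝ) : Prop where
  continuous : Continuous N
  nonneg : ∀ g, 0 ≤ N g
  eq_zero_iff : ∀ g, N g = 0 ↔ g = 1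
  dilation : ∀ (r : ℝ), 0 < r → ∀ g, N (dilation X deg r g) = r * N g
  inv : ∀ g, N g⁻¹ = N g

/-- A left-invariant homogeneous distance on `G`. -/
structure IsHomogeneousDistance (d : G → G → ℝ) : Prop where
  continuous : Continuous (fun p : G × G => d p.1 p.2)
  eq_zero_iff : ∀ x y, d x y = 0 ↔ x = y
  symm : ∀ x y, d x y = d y x
  triangle : ∀ x y z, d x z ≤ d x y + d y z
  mul_left : ∀ g x y, d (g * x) (g * y) = d x y
  dilation : ∀ (r : ℝ), 0 < r → ∀ x y, d (dilation X deg r x) (dilation X deg r y) = r * d x y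

/-- A homogeneous subgroup: a subgroup closed under the dilations. -/
def IsHomogeneous (H : Subgroup G) : Prop :=
  ∀ r : ℝ, 0 < r → ∀ x ∈ H, dilation X deg r x ∈ H

/-- `W` and `L` are complementary (homogeneous) subgroups, with `L = exp (span {X_i : i < k})`
horizontal and `k`-dimensional, and `W = exp (span {X_i : k ≤ i})`. Indices start from `0`. -/
structure IsHorizontalSplitting (k : ℕ) (W L : Subgroup G) : Prop where
  le : k ≤ n
  horizontal : ∀ i : Fin n, (i : ℕ) < k → deg i = 1
  L_eq : (L : Set G) = (Submodule.span ℝ (X '' {i | (i : ℕ) < k}) : Set G)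
  W_eq : (W : Set G) = (Submodule.span ℝ (X '' {i | k ≤ (i : ℕ)}) : Set G)
  homogeneous_W : IsHomogeneous X deg W
  homogeneous_L : IsHomogeneous X deg L
  /-- Every `g` is `w * l` for exactly one pair `w ∈ W`, `l ∈ L`. -/
  isComplement : Subgroup.IsComplement' W L

end Group

/-! ### Functions `φ : U ⊆ W → L`

Such a function is a map `φ : W → L` of which only the values on `U` are used. -/

section Maps

variable {G : Type*} [Group G] {W L : Subgroup G}

/-- The projection `π_W`: the `W`-component in `G = W · L`. -/
def projW (h : Subgroup.IsComplement' W L) (g : G) : W := (h.equiv g).1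

/-- The projection `π_L`: the `L`-component in `G = W · L`. -/
def projL (h : Subgroup.IsComplement' W L) (g : G) : L := (h.equiv g).2

/-- The domain `U_q` of the intrinsic translation `φ_q`. -/
def translatedDomain (h : Subgroup.IsComplement' W L) (U : Set W) (q : G) : Set W :=
  {a | projW h (q⁻¹ * a) ∈ U}

/-- The intrinsic translation `φ_q`. -/
def translatedMap (h : Subgroup.IsComplement' W L) (φ : W → L) (q : G) (a : W) : L :=
  (projL h (q⁻¹ * a))⁻¹ * φ (projW h (q⁻¹ * a))

end Maps

section Regularity

variable {G : Type*} [NormedAddCommGroup G] [NormedSpace ℝ G] [Group G] {n : ℕ}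
  (X : Module.Basis (Fin n) ℝ G) (deg : Fin n → ℕ) (N : G → ℝ) (d : G → G → ℝ) (k : ℕ)
  {W L : Subgroup G} (h : Subgroup.IsComplement' W L)

/-- Indices of the basis vectors spanning the Lie algebra of `L`. -/
abbrev LIndex (n k : ℕ) : Type := {i : Fin n // (i : ℕ) < k}

/-- Indices of the basis vectors spanning the first layer of the Lie algebra of `W`. -/
abbrev HIndex (deg : Fin n → ℕ) (k : ℕ) : Type := {j : Fin n // k ≤ (j : ℕ) ∧ deg j = 1}

/-- The exponential coordinates, in `ℝ^k`, of an element of `L`. -/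
def coordL (l : L) : EuclideanSpace ℝ (LIndex n k) :=
  WithLp.toLp 2 fun i => X.repr (l : G) i

/-- `ℓ : W → L` is intrinsically linear: its intrinsic graph is a homogeneous subgroup. -/
def IsIntrinsicallyLinear (ℓ : W → L) : Prop :=
  ∃ H : Subgroup G, (H : Set G) = {g | ∃ w : W, g = (w : G) * (ℓ w : G)} ∧ IsHomogeneous X deg H

/-- The point `p_a = φ(a)⁻¹ · a⁻¹`. -/
def basePoint (φ : W → L) (a : W) : G := (φ a : G)⁻¹ * (a : G)⁻¹

/-- `ℓ` is an intrinsic differential of `φ : U → L` at `a₀`. -/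
def IsIntrinsicDifferentialAt (U : Set W) (φ : W → L) (a₀ : W) (ℓ : W → L) : Prop :=
  IsIntrinsicallyLinear X deg ℓ ∧
    ∀ ε > 0, ∃ r > 0, ∀ b ∈ translatedDomain h U (basePoint φ a₀), 0 < N b → N b < r →
      N (((ℓ b)⁻¹ * translatedMap h φ (basePoint φ a₀) b : L) : G) / N b ≤ ε

/-- `φ : U → L` is uniformly intrinsically differentiable at `a₀`. -/
def IsUIDAt (U : Set W) (φ : W → L) (a₀ : W) : Prop :=
  ∃ ℓ : W → L, IsIntrinsicDifferentialAt X deg N h U φ a₀ ℓ ∧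
    ∀ ε > 0, ∃ r > 0, ∀ a ∈ U, d a₀ a < r →
      ∀ b ∈ translatedDomain h U (basePoint φ a), d 1 b < r → b ≠ 1 →
        N (((ℓ b)⁻¹ * translatedMap h φ (basePoint φ a) b : L) : G) / N b ≤ ε

/-- `φ : U → L` is uniformly intrinsically differentiable on `U`. -/
def IsUIDOn (U : Set W) (φ : W → L) : Prop :=
  ∀ a₀ ∈ U, IsUIDAt X deg N d h U φ a₀

/-- `φ` is intrinsically differentiable at `a₀` and its intrinsic gradient there is the linear map
`Lie(W) ∩ V₁ → Lie(L)` with matrix `M`: the intrinsic differential maps `exp Y` to `exp (M Y)`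
for every `Y ∈ Lie(W) ∩ V₁`. -/
def HasIntrinsicGradientAt (U : Set W) (φ : W → L) (a₀ : W)
    (M : Matrix (LIndex n k) (HIndex deg k) ℝ) : Prop :=
  (∃ ℓ : W → L, IsIntrinsicDifferentialAt X deg N h U φ a₀ ℓ) ∧
    ∀ ℓ : W → L, IsIntrinsicDifferentialAt X deg N h U φ a₀ ℓ →
      ∀ (y : HIndex deg k → ℝ) (w : W), (w : G) = ∑ j, y j • X (j : Fin n) →
        (ℓ w : G) = ∑ i, M.mulVec y i • X (i : Fin n)

/-- The projected vector field `D^φ_x` at `w`: the differential of `π_W` at `w · φ(w)` applied to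
the left-invariant field `x` at that point. -/
def projectedField (φ : W → L) (x : G) (w : W) : G :=
  fderiv ℝ (fun g : G => (projW h g : G)) ((w : G) * (φ w : G))
    (leftInvariant x ((w : G) * (φ w : G)))

/-- `γ` is, on `[-T, T]`, a `C¹` solution of `γ' = D^φ_x ∘ γ`, `γ 0 = a`. -/
def IsProjectedCurve (φ : W → L) (x : G) (T : ℝ) (a : W) (γ : ℝ → W) : Prop :=
  ContDiffOn ℝ 1 (fun t => (γ t : G)) (Icc (-T) T) ∧
    (∀ t ∈ Icc (-T) T,
      HasDerivWithinAt (fun t => (γ t : G)) (projectedField h φ x (γ t)) (Icc (-T) T) t) ∧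
    γ 0 = a

/-- `D^φ φ = ω` on `U` in the broad* sense, with respect to the adapted basis `X`. -/
def IsBroadStar (U : Set W) (φ : W → L) (ω : W → Matrix (LIndex n k) (HIndex deg k) ℝ) : Prop :=
  ∀ a₀ ∈ U, ∃ δ₁ δ₂ : ℝ, 0 < δ₂ ∧ δ₂ < δ₁ ∧
    ∃ E : HIndex deg k → W → ℝ → W, ∀ j, ∀ a ∈ U, d a₀ a ≤ δ₂ →
      (∀ t ∈ Icc (-δ₂) δ₂, E j a t ∈ U ∧ d a₀ (E j a t) ≤ δ₁) ∧
      IsProjectedCurve h φ (X (j : Fin n)) δ₂ a (E j a) ∧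
      ∀ t ∈ Icc (-δ₂) δ₂, ∀ i : LIndex n k,
        coordL X k (φ (E j a t)) i - coordL X k (φ a) i = ∫ r in (0 : ℝ)..t, ω (E j a r) i j

/-- `φ` is vertically broad* hölder on `U`, with respect to the adapted basis `X`. -/
def IsVerticallyBroadStarHolder (U : Set W) (φ : W → L) : Prop :=
  ∀ a₀ ∈ U, ∃ δ > 0, ∃ U₁ ∈ 𝓝 a₀, ∃ U₂ ∈ 𝓝 a₀,
    IsCompact (closure U₁) ∧ closure U₁ ⊆ U₂ ∧ IsCompact (closure U₂) ∧ closure U₂ ⊆ U ∧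
    ∃ E : {j : Fin n // 1 < deg j} → W → ℝ → W,
      (∀ j, ∀ a ∈ U₁, (∀ t ∈ Icc (-δ) δ, E j a t ∈ U₂) ∧
        IsProjectedCurve h φ (X (j : Fin n)) δ a (E j a)) ∧
      ∀ ε > 0, ∃ ρ > 0, ∀ j, ∀ a ∈ U₁, ∀ t ∈ Icc (-δ) δ, ∀ t' ∈ Icc (-δ) δ,
        0 < |t - t'| → |t - t'| ≤ ρ →
          ‖coordL X k (φ (E j a t)) - coordL X k (φ (E j a t'))‖ /
            |t - t'| ^ (1 / (deg j : ℝ)) ≤ ε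

end Regularity

end

end Carnot

/-!
The translations of the graph make the problem homogeneous. Seen from the point `a * φ a` of the
graph, a point `c` of `W` becomes `relPoint X k φ a c = (φ a)⁻¹ * a⁻¹ * c * φ a`, and the
intrinsic difference quotients at `a` compare `φ c - φ a` with a linear function of the
coordinates of degree one of `b = relPoint X k φ a c`, at the scale `R = d 1 b`. It is therefore
enough to expand `φ` up to `o(R)`, uniformly for `a` near `a₀`, with linear part `ω a₀`
(`exists_norm_sub_partialGrad_le`).

The point `c` is reached from `a` by flowing along the given integral curves of
`D^φ_k, …, D^φ_{n-1}` in this order. These curves need be neither unique nor continuous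
in the starting point, but none of this is needed, because the projected fields are triangular: along a curve of
`D^φ_j`, the coordinates of degree at most `deg j` of `relPoint` are constant, except for the
`j`-th one, which has speed one (`repr_projField`, `repr_eq_of_curve`). So the time of the `j`-th
flow is forced, it is the current error in the `j`-th coordinate, and after the last flow all
coordinates are those of `b`. All points on the way stay at distance `O(R)` and the `j`-th time is
`O(R ^ deg j)`: this is `exists_dist_le_of_curve`, which follows by dilating to `R = 1` and
translating the starting point to `1`, where it only says that a continuous field is locally
bounded. Along the `j`-th flow the function `φ` changes by the integral of the column `j` of `ω`
if `deg j = 1`, hence by `ω a₀` times the time up to `o(R)`, and by `o(R)` if `deg j > 1`, by the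
hölder condition (`HasExpansionAt`, `HasPartialExpansion.succ`).

The homogeneity used throughout is that dilations are automorphisms of the group. They preserve
brackets, as the first layer generates the Lie algebra (`dilation_lieBracket`), and a linear map
preserving brackets is a homomorphism in exponential coordinates (`map_mul_of_map_lieBracket`):
the inverse `B` of the differential of left translations is determined by the bracket, since
`t • B (t • x)` solves `C' = 1 - ad x ∘ C`, and integral curves of left-invariant fields are translates
of one-parameter subgroups. Homogeneity gives in turn that coordinates of degree one are additive,
that `W` is normal, that `L` is abelian, and the triangularity of the projected fields.

Finally, intrinsic differentials commute with dilations, so two of them that agree to first order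
at `1` are equal (`IsIntrinsicDifferentialAt.eq`); this identifies the gradient.
-/

set_option linter.unusedSectionVars false

namespace Carnot

noncomputable section

/-! ### Left translations and left-invariant fields -/

section LieTheory

variable {G : Type*} [NormedAddCommGroup G] [NormedSpace ℝ G] [Group G]

/-- The differential at `1` of the left translation by `p`. -/
def leftDeriv (p : G) : G →L[ℝ] G := fderiv ℝ (fun y : G => p * y) 1

/-- The inverse of `leftDeriv p`: the differential at `p` of the left translation by `p⁻¹`. -/
def leftDerivInv (p : G) : G →L[ℝ] G := fderiv ℝ (fun y : G => p⁻¹ * y) p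

theorem leftDeriv_one : leftDeriv (1 : G) = ContinuousLinearMap.id ℝ G := by
  unfold leftDeriv; simp

theorem one_eq_zero_of_exp (hexp : ∀ (a b : ℝ) (x : G), (a + b) • x = (a • x) * (b • x)) :
    (1 : G) = 0 := by
  have := hexp 0 0 0
  simp only [smul_zero] at this
  exact (left_eq_mul.1 this).symm

theorem inv_eq_neg_of_exp (hexp : ∀ (a b : ℝ) (x : G), (a + b) • x = (a • x) * (b • x)) (x : G) :
    x⁻¹ = -x := by
  have := hexp 1 (-1) x
  rw [add_neg_cancel, zero_smul, ← one_eq_zero_of_exp hexp, one_smul, neg_one_smul] at this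
  exact (eq_inv_of_mul_eq_one_right this.symm).symm

variable [LieGroup 𝓘(ℝ, G) ((⊤ : ℕ∞) : WithTop ℕ∞) G]

theorem contDiff_mul : ContDiff ℝ ((⊤ : ℕ∞) : WithTop ℕ∞) (fun p : G × G => p.1 * p.2) := by
  have h := _root_.contMDiff_mul 𝓘(ℝ, G) ((⊤ : ℕ∞) : WithTop ℕ∞) (G := G)
  rw [← modelWithCornersSelf_prod, chartedSpaceSelf_prod] at h
  exact h.contDiff

theorem contDiff_inv : ContDiff ℝ ((⊤ : ℕ∞) : WithTop ℕ∞) (fun p : G => p⁻¹) :=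
  (_root_.contMDiff_inv 𝓘(ℝ, G) ((⊤ : ℕ∞) : WithTop ℕ∞) (G := G)).contDiff

theorem contDiff_fun_mul {E : Type*} [NormedAddCommGroup E] [NormedSpace ℝ E] {f g : E → G}
    (hf : ContDiff ℝ ((⊤ : ℕ∞) : WithTop ℕ∞) f) (hg : ContDiff ℝ ((⊤ : ℕ∞) : WithTop ℕ∞) g) :
    ContDiff ℝ ((⊤ : ℕ∞) : WithTop ℕ∞) (fun x => f x * g x) :=
  contDiff_mul.comp (hf.prodMk hg)

theorem contDiff_const_mul (g : G) : ContDiff ℝ ((⊤ : ℕ∞) : WithTop ℕ∞) (fun p : G => g * p) :=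
  contDiff_fun_mul contDiff_const contDiff_id

theorem differentiable_const_mul (g : G) : Differentiable ℝ (fun p : G => g * p) :=
  (contDiff_const_mul g).differentiable (by simp)

theorem contDiff_leftDeriv : ContDiff ℝ ((⊤ : ℕ∞) : WithTop ℕ∞) (leftDeriv : G → G →L[ℝ] G) :=
  ContDiff.fderiv (f := fun p y : G => p * y) (m := ((⊤ : ℕ∞) : WithTop ℕ∞)) contDiff_mul
    contDiff_const (by simp)

theorem contDiff_leftDerivInv :
    ContDiff ℝ ((⊤ : ℕ∞) : WithTop ℕ∞) (leftDerivInv : G → G →L[ℝ] G) :=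
  ContDiff.fderiv (f := fun p y : G => p⁻¹ * y) (m := ((⊤ : ℕ∞) : WithTop ℕ∞))
    (contDiff_fun_mul (contDiff_inv.comp contDiff_fst) contDiff_snd) contDiff_id (by simp)

/-- Chain rule for left translations. -/
theorem fderiv_const_mul_leftDeriv (q g x : G) :
    fderiv ℝ (fun y : G => q * y) g (leftDeriv g x) = leftDeriv (q * g) x := by
  have h : (fun y : G => q * g * y) = (fun y : G => q * y) ∘ (fun y : G => g * y) := by
    funext y; simp [mul_assoc]
  unfold leftDeriv
  rw [h, fderiv_comp]
  · simp
  · exact differentiable_const_mul q _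
  · exact differentiable_const_mul g _

theorem leftDerivInv_leftDeriv (p x : G) : leftDerivInv p (leftDeriv p x) = x := by
  have := fderiv_const_mul_leftDeriv p⁻¹ p x
  rw [inv_mul_cancel, leftDeriv_one] at this
  exact this

theorem leftDeriv_leftDerivInv (p x : G) : leftDeriv p (leftDerivInv p x) = x := by
  have h : (id : G → G) = (fun y : G => p * y) ∘ (fun y : G => p⁻¹ * y) := by
    funext y; simp
  have h2 : fderiv ℝ ((fun y : G => p * y) ∘ (fun y : G => p⁻¹ * y)) p
      = (leftDeriv p).comp (leftDerivInv p) := by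
    rw [fderiv_comp]
    · simp [leftDeriv, leftDerivInv]
    · exact differentiable_const_mul p _
    · exact differentiable_const_mul p⁻¹ _
  rw [← h, fderiv_id] at h2
  exact (congrArg (fun f : G →L[ℝ] G => f x) h2).symm

theorem hasDerivAt_mul_smul [FiniteDimensional ℝ G] (h1 : (1 : G) = 0) (g z : G) :
    HasDerivAt (fun h : ℝ => g * (h • z)) (leftDeriv g z) 0 := by
  have h2 : HasFDerivAt (fun y : G => g * y) (leftDeriv g) ((0 : ℝ) • z) := by
    rw [zero_smul, ← h1]
    exact (differentiable_const_mul g 1).hasFDerivAt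
  have h3 : HasDerivAt (fun h : ℝ => h • z) z 0 := by
    simpa using (hasDerivAt_id (0 : ℝ)).smul_const z
  exact h2.comp_hasDerivAt (0 : ℝ) h3

variable [FiniteDimensional ℝ G]

/-- The one-parameter subgroup of `p` has velocity `p` at `p`. -/
theorem leftDeriv_self (hexp : ∀ (a b : ℝ) (x : G), (a + b) • x = (a • x) * (b • x)) (p : G) :
    leftDeriv p p = p := by
  have h := hasDerivAt_mul_smul (one_eq_zero_of_exp hexp) p p
  have h2 : (fun h : ℝ => p * (h • p)) = fun h : ℝ => (1 + h) • p := by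
    funext t; rw [hexp, one_smul]
  rw [h2] at h
  have h3 : HasDerivAt (fun h : ℝ => (1 + h) • p) ((1 : ℝ) • p) 0 :=
    ((hasDerivAt_id (0 : ℝ)).const_add 1).smul_const p
  rw [one_smul] at h3
  exact h.unique h3

/-- Integral curves of a left-invariant field are translates of one-parameter subgroups. -/
theorem eq_mul_smul_of_hasDerivAt
    (hexp : ∀ (a b : ℝ) (x : G), (a + b) • x = (a • x) * (b • x)) {u : ℝ → G} {z : G}
    (hu : ∀ t, HasDerivAt u (leftDeriv (u t) z) t) (t : ℝ) : u t = u 0 * (t • z) := by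
  have h1 := one_eq_zero_of_exp hexp
  -- `u t * (-t • z)` is constant: its derivative is that of the constant curve
  -- `h ↦ (u t * h • z) * ((-t - h) • z)`.
  have key : ∀ t, HasDerivAt (fun t => u t * ((-t) • z)) 0 t := by
    intro t
    have hm : HasFDerivAt (fun p : G × G => p.1 * p.2)
        (fderiv ℝ (fun p : G × G => p.1 * p.2) (u t, (-t) • z)) (u t, (-t) • z) :=
      ((contDiff_mul (G := G)).differentiable (by simp) _).hasFDerivAt
    have c1 : HasDerivAt (fun t => (u t, (-t) • z)) (leftDeriv (u t) z, (-1 : ℝ) • z) t :=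
      (hu t).prodMk ((hasDerivAt_neg t).smul_const z)
    have c2 : HasDerivAt (fun h : ℝ => (u t * (h • z), (-t - h) • z))
        (leftDeriv (u t) z, (-1 : ℝ) • z) 0 :=
      (hasDerivAt_mul_smul h1 (u t) z).prodMk
        (((hasDerivAt_id (0 : ℝ)).const_sub (-t)).smul_const z)
    have e : (u t * ((0 : ℝ) • z), (-t - 0) • z) = (u t, (-t) • z) := by
      simp [← h1]
    have c2' := HasFDerivAt.comp_hasDerivAt (0 : ℝ) (by rw [e]; exact hm) c2
    have c3 : ((fun p : G × G => p.1 * p.2) ∘ fun h : ℝ => (u t * (h • z), (-t - h) • z)) =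
        fun _ => u t * ((-t) • z) := by
      funext h
      have : (-t : ℝ) = h + (-t - h) := by ring
      simp only [Function.comp]
      rw [mul_assoc, ← hexp, ← this]
    rw [c3] at c2'
    have c4 := c2'.unique (hasDerivAt_const (0 : ℝ) _)
    have c5 := hm.comp_hasDerivAt t c1
    rw [c4] at c5
    exact c5
  have hc := is_const_of_deriv_eq_zero (fun t => (key t).differentiableAt)
    (fun t => (key t).deriv) t 0
  simp only [neg_zero, zero_smul, ← h1, mul_one] at hc
  rw [← hc, mul_assoc, ← hexp]
  simp [← h1]

instance instLieGroupMinSmoothness : LieGroup 𝓘(ℝ, G) (minSmoothness ℝ 3) G :=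
  LieGroup.of_le (n := ((⊤ : ℕ∞) : WithTop ℕ∞)) (by
    simpa using (WithTop.coe_le_coe.2 (le_top : (3 : ℕ∞) ≤ ⊤) :
      ((3 : ℕ∞) : WithTop ℕ∞) ≤ ((⊤ : ℕ∞) : WithTop ℕ∞)))

theorem lieBracket_leftDeriv (x y p : G) :
    fderiv ℝ (fun g => leftDeriv g y) p (leftDeriv p x)
      - fderiv ℝ (fun g => leftDeriv g x) p (leftDeriv p y) = leftDeriv p (lieBracket x y) := by
  have e : ∀ z : G, (mulInvariantVectorField (I := 𝓘(ℝ, G)) (G := G) z : G → G) =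
      leftInvariant z := fun z => by
    funext g
    exact congrArg (fun f : G →L[ℝ] G => f z) (mfderiv_eq_fderiv (f := fun p : G => g * p) (x := 1))
  have hB : ∀ g : G, VectorField.mlieBracket 𝓘(ℝ, G)
      (mulInvariantVectorField (I := 𝓘(ℝ, G)) (G := G) x)
      (mulInvariantVectorField (I := 𝓘(ℝ, G)) (G := G) y) g =
      VectorField.lieBracket ℝ (leftInvariant x) (leftInvariant y) g := fun g => by
    rw [← VectorField.mlieBracketWithin_univ, VectorField.mlieBracketWithin_eq_lieBracketWithin]
    refine Eq.trans (congrFun VectorField.lieBracketWithin_univ g) ?_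
    exact congrArg₂ (fun v w : G → G => VectorField.lieBracket ℝ v w g) (e x) (e y)
  have h := congrFun (mulInvariantVector_mlieBracket (I := 𝓘(ℝ, G)) (G := G) x y) p
  have h2 := (congrFun (e _) p).symm.trans (h.trans (hB p))
  exact h2.symm.trans (congrArg (leftDeriv p) (hB 1))

end LieTheory

/-! ### Homomorphisms in exponential coordinates -/

section Homomorphisms

variable {G : Type*} [NormedAddCommGroup G] [NormedSpace ℝ G] [Group G]
  [LieGroup 𝓘(ℝ, G) ((⊤ : ℕ∞) : WithTop ℕ∞) G] [FiniteDimensional ℝ G]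

theorem lieBracket_add (x y z : G) : lieBracket x (y + z) = lieBracket x y + lieBracket x z := by
  simp only [lieBracket_eq_groupLieAlgebra]
  exact lie_add (L := GroupLieAlgebra 𝓘(ℝ, G) G) (M := GroupLieAlgebra 𝓘(ℝ, G) G) x y z

theorem add_lieBracket (x y z : G) : lieBracket (x + y) z = lieBracket x z + lieBracket y z := by
  simp only [lieBracket_eq_groupLieAlgebra]
  exact add_lie (L := GroupLieAlgebra 𝓘(ℝ, G) G) (M := GroupLieAlgebra 𝓘(ℝ, G) G) x y z

theorem lieBracket_smul (c : ℝ) (x y : G) : lieBracket x (c • y) = c • lieBracket x y := by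
  simp only [lieBracket_eq_groupLieAlgebra]
  exact lie_smul (L := GroupLieAlgebra 𝓘(ℝ, G) G) (M := GroupLieAlgebra 𝓘(ℝ, G) G) c x y

theorem smul_lieBracket (c : ℝ) (x y : G) : lieBracket (c • x) y = c • lieBracket x y := by
  simp only [lieBracket_eq_groupLieAlgebra]
  exact smul_lie (L := GroupLieAlgebra 𝓘(ℝ, G) G) (M := GroupLieAlgebra 𝓘(ℝ, G) G) c x y

theorem lieBracket_lieBracket (x y z : G) :
    lieBracket (lieBracket x y) z
      = lieBracket x (lieBracket y z) - lieBracket y (lieBracket x z) := by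
  have h := lieBracket_eq_groupLieAlgebra (G := G)
  rw [h (lieBracket x y) z, h x (lieBracket y z), h y (lieBracket x z), h x y, h y z, h x z]
  exact lie_lie (L := GroupLieAlgebra 𝓘(ℝ, G) G) (M := GroupLieAlgebra 𝓘(ℝ, G) G) x y z

/-- `lieBracket x` as a continuous linear map. -/
def adjointMap (x : G) : G →L[ℝ] G :=
  LinearMap.toContinuousLinearMap
    { toFun := lieBracket x
      map_add' := lieBracket_add x
      map_smul' := fun c y => lieBracket_smul c x y }

@[simp] theorem adjointMap_apply (x y : G) : adjointMap x y = lieBracket x y := rfl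

/-- The radial derivative of `leftDeriv`, which determines `leftDeriv` from the bracket. -/
theorem fderiv_leftDeriv_self (hexp : ∀ (a b : ℝ) (x : G), (a + b) • x = (a • x) * (b • x))
    (p y : G) :
    fderiv ℝ leftDeriv p p y
      = leftDeriv p (lieBracket p y) + leftDeriv p y - leftDeriv p (leftDeriv p y) := by
  have hA : HasFDerivAt (leftDeriv : G → G →L[ℝ] G) (fderiv ℝ leftDeriv p) p :=
    (contDiff_leftDeriv.differentiable (by simp) p).hasFDerivAt
  have e1 : ∀ z h : G, fderiv ℝ (fun g => leftDeriv g z) p h = fderiv ℝ leftDeriv p h z := by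
    intro z h
    have := hA.clm_apply (hasFDerivAt_const z p)
    rw [this.fderiv]; simp
  have e2 : ∀ h : G, fderiv ℝ leftDeriv p h p + leftDeriv p h = h := by
    intro h
    have h1 := hA.clm_apply (hasFDerivAt_id p)
    have h2 : (fun g : G => leftDeriv g (id g)) = id := by
      funext g; exact leftDeriv_self hexp g
    rw [h2] at h1
    have h3 := congrArg (fun f : G →L[ℝ] G => f h) (h1.unique (hasFDerivAt_id p))
    simpa [add_comm] using h3
  have h1 := lieBracket_leftDeriv p y p
  rw [e1, e1, leftDeriv_self hexp] at h1
  have h2 := e2 (leftDeriv p y)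
  rw [← h1, add_sub_assoc, ← eq_sub_of_add_eq h2, sub_add_cancel]

/-- The radial derivative of `leftDerivInv`. -/
theorem fderiv_leftDerivInv_self (hexp : ∀ (a b : ℝ) (x : G), (a + b) • x = (a • x) * (b • x))
    (p z : G) :
    fderiv ℝ leftDerivInv p p z = z - leftDerivInv p z - lieBracket p (leftDerivInv p z) := by
  have hA : HasFDerivAt (leftDeriv : G → G →L[ℝ] G) (fderiv ℝ leftDeriv p) p :=
    (contDiff_leftDeriv.differentiable (by simp) p).hasFDerivAt
  have hB : HasFDerivAt (leftDerivInv : G → G →L[ℝ] G) (fderiv ℝ leftDerivInv p) p :=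
    (contDiff_leftDerivInv.differentiable (by simp) p).hasFDerivAt
  have h1 := hB.clm_apply (hA.clm_apply (hasFDerivAt_const (leftDerivInv p z) p))
  have h2 : (fun g : G => leftDerivInv g (leftDeriv g (leftDerivInv p z)))
      = fun _ => leftDerivInv p z := by
    funext g; rw [leftDerivInv_leftDeriv]
  rw [h2] at h1
  have h3 := congrArg (fun f : G →L[ℝ] G => f p) (h1.unique (hasFDerivAt_const _ p))
  simp [leftDeriv_leftDerivInv, fderiv_leftDeriv_self hexp, leftDerivInv_leftDeriv] at h3
  rw [eq_comm, ← sub_eq_zero, ← neg_eq_zero, ← h3]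
  abel

/-- `t • leftDerivInv (t • x)` solves the linear equation `C' = 1 - ad x ∘ C`. -/
theorem hasDerivAt_smul_leftDerivInv
    (hexp : ∀ (a b : ℝ) (x : G), (a + b) • x = (a • x) * (b • x)) (x z : G) (t : ℝ) :
    HasDerivAt (fun t : ℝ => t • leftDerivInv (t • x) z)
      (z - lieBracket x (t • leftDerivInv (t • x) z)) t := by
  have hB : HasFDerivAt (leftDerivInv : G → G →L[ℝ] G) (fderiv ℝ leftDerivInv (t • x)) (t • x) :=
    (contDiff_leftDerivInv.differentiable (by simp) _).hasFDerivAt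
  have h1 : HasDerivAt (fun t : ℝ => t • x) x t := by
    simpa using (hasDerivAt_id t).smul_const x
  have h2 : HasDerivAt (fun t : ℝ => leftDerivInv (t • x)) (fderiv ℝ leftDerivInv (t • x) x) t :=
    HasFDerivAt.comp_hasDerivAt (f := fun t : ℝ => t • x) t hB h1
  have h3 : HasDerivAt (fun t : ℝ => leftDerivInv (t • x) z)
      (fderiv ℝ leftDerivInv (t • x) x z) t := by
    simpa using h2.clm_apply (hasDerivAt_const t z)
  have h4 : HasDerivAt (fun t : ℝ => t • leftDerivInv (t • x) z)
      (t • fderiv ℝ leftDerivInv (t • x) x z + (1 : ℝ) • leftDerivInv (t • x) z) t :=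
    (hasDerivAt_id' t).fun_smul h3
  have h5 := fderiv_leftDerivInv_self hexp (t • x) z
  rw [map_smul (fderiv ℝ leftDerivInv (t • x)) t x, smul_apply,
    smul_lieBracket] at h5
  rw [h5, one_smul] at h4
  rw [lieBracket_smul]
  exact h4.congr_deriv (by abel)

/-- A linear map preserving brackets intertwines the differentials of left translations. -/
theorem map_leftDerivInv (hexp : ∀ (a b : ℝ) (x : G), (a + b) • x = (a • x) * (b • x))
    (D : G →L[ℝ] G) (hD : ∀ x y, D (lieBracket x y) = lieBracket (D x) (D y)) (x z : G) :
    D (leftDerivInv x z) = leftDerivInv (D x) (D z) := by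
  have h := ODE_solution_unique_univ (E := G) (v := fun _ u => D z - adjointMap (D x) u)
    (s := fun _ => univ) (K := ‖adjointMap (D x)‖₊) (t₀ := 0)
    (f := fun t : ℝ => D (t • leftDerivInv (t • x) z))
    (g := fun t : ℝ => t • leftDerivInv (t • D x) (D z))
    (fun t => by
      refine LipschitzWith.lipschitzOnWith (LipschitzWith.of_dist_le_mul fun u v => ?_)
      rw [dist_sub_left, dist_eq_norm, dist_eq_norm, ← map_sub]
      exact (adjointMap (D x)).le_opNorm _)
    (fun t => ⟨by
      have := D.hasFDerivAt.comp_hasDerivAt t (hasDerivAt_smul_leftDerivInv hexp x z t)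
      rw [map_sub, hD] at this
      exact this, trivial⟩)
    (fun t => ⟨hasDerivAt_smul_leftDerivInv hexp (D x) (D z) t, trivial⟩)
    (by simp)
  simpa using congrFun h 1

theorem map_leftDeriv (hexp : ∀ (a b : ℝ) (x : G), (a + b) • x = (a • x) * (b • x))
    (D : G →L[ℝ] G) (hD : ∀ x y, D (lieBracket x y) = lieBracket (D x) (D y)) (x z : G) :
    D (leftDeriv x z) = leftDeriv (D x) (D z) := by
  have h := map_leftDerivInv hexp D hD x (leftDeriv x z)
  rw [leftDerivInv_leftDeriv] at h
  rw [h, leftDeriv_leftDerivInv]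

/-- In exponential coordinates, a homomorphism of Lie algebras is a homomorphism of groups. -/
theorem map_mul_of_map_lieBracket (hexp : ∀ (a b : ℝ) (x : G), (a + b) • x = (a • x) * (b • x))
    (D : G →L[ℝ] G) (hD : ∀ x y, D (lieBracket x y) = lieBracket (D x) (D y)) (x y : G) :
    D (x * y) = D x * D y := by
  have h1 := one_eq_zero_of_exp hexp
  have key : ∀ t : ℝ, HasDerivAt (fun t : ℝ => D (x * (t • y)))
      (leftDeriv (D (x * (t • y))) (D y)) t := by
    intro t
    rw [← map_leftDeriv hexp D hD]
    refine D.hasFDerivAt.comp_hasDerivAt t ?_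
    have h := hasDerivAt_mul_smul h1 (x * (t • y)) y
    have h2 : (fun u : ℝ => x * (u • y)) = fun u => x * (t • y) * ((u - t) • y) := by
      funext u
      rw [mul_assoc, ← hexp, add_sub_cancel]
    rw [h2]
    exact HasDerivAt.comp_sub_const t t (by simpa using h)
  have := eq_mul_smul_of_hasDerivAt hexp key 1
  simpa [← h1] using this

end Homomorphisms

/-! ### Dilations -/

section Dilations

variable {G : Type*} [NormedAddCommGroup G] [NormedSpace ℝ G]
  {n : ℕ} {X : Module.Basis (Fin n) ℝ G} {deg : Fin n → ℕ}

theorem repr_dilation (r : ℝ) (x : G) (i : Fin n) :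
    X.repr (dilation X deg r x) i = r ^ deg i * X.repr x i := by
  unfold dilation
  rw [X.repr_sum_self]

theorem dilation_basis (r : ℝ) (i : Fin n) : dilation X deg r (X i) = r ^ deg i • X i := by
  refine X.ext_elem fun j => ?_
  rw [repr_dilation]
  simp only [Module.Basis.repr_self, map_smul, Finsupp.smul_apply, smul_eq_mul,
    Finsupp.single_apply]
  split_ifs with h
  · rw [h]
  · simp

variable [FiniteDimensional ℝ G]

variable (X deg) in
/-- The dilation `dilation X deg r` as a continuous linear map. -/
def dilationMap (r : ℝ) : G →L[ℝ] G :=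
  LinearMap.toContinuousLinearMap
    { toFun := dilation X deg r
      map_add' := fun x y => X.ext_elem fun j => by
        simp only [repr_dilation, map_add, Finsupp.add_apply]; ring
      map_smul' := fun c x => X.ext_elem fun j => by
        simp only [repr_dilation, map_smul, Finsupp.smul_apply, smul_eq_mul, RingHom.id_apply]
        ring }

@[simp] theorem dilationMap_apply (r : ℝ) (x : G) : dilationMap X deg r x = dilation X deg r x :=
  rfl

variable [Group G]

theorem dilation_of_mem_layer {s : ℕ} {V : ℕ → Submodule ℝ G} (hX : IsAdaptedBasis s V X deg)
    {j : ℕ} (hj : j ∈ Finset.Icc 1 s) (r : ℝ) {x : G} (hx : x ∈ V j) :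
    dilationMap X deg r x = r ^ j • x := by
  rw [← hX.span_layer j hj] at hx
  induction hx using Submodule.span_induction with
  | mem x h =>
    obtain ⟨i, hi, rfl⟩ := h
    rw [dilationMap_apply, dilation_basis, hi]
  | zero => rw [map_zero, smul_zero]
  | add x y _ _ hx hy => rw [map_add, hx, hy, smul_add]
  | smul c x _ hx => rw [map_smul, hx, smul_comm]

theorem basis_mem_layer {s : ℕ} {V : ℕ → Submodule ℝ G} (hX : IsAdaptedBasis s V X deg)
    (i : Fin n) : X i ∈ V (deg i) := by
  rw [← hX.span_layer _ (hX.deg_mem i)]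
  exact Submodule.subset_span ⟨i, rfl, rfl⟩

variable [LieGroup 𝓘(ℝ, G) ((⊤ : ℕ∞) : WithTop ℕ∞) G]

/-- Dilations preserve brackets. The vectors `x` with
`dilation [x, y] = [dilation x, dilation y]` for all `y` form a Lie subalgebra by the Jacobi
identity, and it contains the first layer, which generates. -/
theorem dilation_lieBracket {s : ℕ} {V : ℕ → Submodule ℝ G} (hG : IsCarnotGroup s V)
    (hX : IsAdaptedBasis s V X deg) (r : ℝ) (x y : G) :
    dilationMap X deg r (lieBracket x y)
      = lieBracket (dilationMap X deg r x) (dilationMap X deg r y) := by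
  set D := dilationMap X deg r with hD
  let M : Submodule ℝ G :=
    { carrier := {x | ∀ y, D (lieBracket x y) = lieBracket (D x) (D y)}
      add_mem' := fun {a b} ha hb y => by
        rw [add_lieBracket, map_add, ha, hb, map_add, add_lieBracket]
      zero_mem' := fun y => by
        have h0 : ∀ z : G, lieBracket 0 z = 0 := fun z => by
          have := smul_lieBracket 0 (0 : G) z
          rwa [zero_smul, zero_smul] at this
        rw [h0, map_zero, h0]
      smul_mem' := fun c a ha y => by
        rw [smul_lieBracket, map_smul, ha, map_smul, smul_lieBracket] }
  have hM : ∀ a ∈ M, ∀ b ∈ M, lieBracket a b ∈ M := fun a ha b hb z => by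
    rw [lieBracket_lieBracket, map_sub, ha, hb, hb, ha, ha, lieBracket_lieBracket]
  have h1 : ∀ a, 1 ≤ s → a ∈ V 1 → a ∈ M := by
    intro a hs ha y
    have hDa : D a = r ^ 1 • a := dilation_of_mem_layer hX (by simp [hs]) r ha
    have key : (D : G →ₗ[ℝ] G) ∘ₗ (adjointMap a : G →ₗ[ℝ] G)
        = (adjointMap (D a) : G →ₗ[ℝ] G) ∘ₗ (D : G →ₗ[ℝ] G) := by
      refine X.ext fun i => ?_
      have hi := Finset.mem_Icc.1 (hX.deg_mem i)
      have hXi := basis_mem_layer hX i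
      have hDi : D (X i) = r ^ deg i • X i := dilation_of_mem_layer hX (hX.deg_mem i) r hXi
      change D (lieBracket a (X i)) = lieBracket (D a) (D (X i))
      rw [hDa, hDi, smul_lieBracket, lieBracket_smul]
      rcases hi.2.lt_or_eq with h | h
      · have hmem : lieBracket a (X i) ∈ V (deg i + 1) := by
          rw [← hG.bracket_layer _ hi.1 h]
          exact Submodule.subset_span ⟨a, ha, X i, hXi, rfl⟩
        rw [hD, dilation_of_mem_layer hX (by simp; omega) r hmem, pow_succ', smul_smul, pow_one]
      · rw [h] at hXi
        rw [hG.bracket_last a ha _ hXi]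
        simp
    exact congrArg (fun f : G →ₗ[ℝ] G => f y) key
  have h2 : ∀ j, 1 ≤ j → j ≤ s → ∀ a ∈ V j, a ∈ M := by
    intro j hj
    induction j, hj using Nat.le_induction with
    | base => exact fun hs a ha => h1 a hs ha
    | succ j hj ih =>
      intro hs a ha
      rw [← hG.bracket_layer j hj (by omega)] at ha
      refine Submodule.span_le.2 ?_ ha
      rintro _ ⟨x, hx, y, hy, rfl⟩
      exact hM x (h1 x (by omega) hx) y (ih (by omega) y hy)
  have h3 : x ∈ M := by
    rw [← X.sum_repr x]
    refine Submodule.sum_mem _ fun i _ => Submodule.smul_mem _ _ ?_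
    have hi := Finset.mem_Icc.1 (hX.deg_mem i)
    exact h2 _ hi.1 hi.2 _ (basis_mem_layer hX i)
  exact h3 y

variable (X deg) in
/-- What the metric arguments use of a Carnot group in exponential coordinates, with an adapted
basis. The main property is that the dilations are automorphisms. -/
structure IsHomogeneousGroup : Prop where
  exp_add : ∀ (a b : ℝ) (x : G), (a + b) • x = (a • x) * (b • x)
  one_le_deg : ∀ i, 1 ≤ deg i
  deg_mono : Monotone deg
  dilation_mul : ∀ (r : ℝ) (x y : G),
    dilation X deg r (x * y) = dilation X deg r x * dilation X deg r y

theorem IsCarnotGroup.isHomogeneousGroup {s : ℕ} {V : ℕ → Submodule ℝ G}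
    (hG : IsCarnotGroup s V) (hX : IsAdaptedBasis s V X deg) : IsHomogeneousGroup X deg where
  exp_add := hG.exp_add
  one_le_deg i := (Finset.mem_Icc.1 (hX.deg_mem i)).1
  deg_mono := hX.deg_mono
  dilation_mul r :=
    map_mul_of_map_lieBracket hG.exp_add (dilationMap X deg r) (dilation_lieBracket hG hX r)

namespace IsHomogeneousGroup

variable (hH : IsHomogeneousGroup X deg)
include hH

theorem one_eq_zero : (1 : G) = 0 := one_eq_zero_of_exp hH.exp_add

theorem dilation_one (r : ℝ) : dilation X deg r (1 : G) = 1 := by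
  rw [hH.one_eq_zero, ← dilationMap_apply, map_zero]

theorem dilation_inv (r : ℝ) (x : G) : dilation X deg r x⁻¹ = (dilation X deg r x)⁻¹ := by
  rw [inv_eq_neg_of_exp hH.exp_add, inv_eq_neg_of_exp hH.exp_add, ← dilationMap_apply, map_neg,
    dilationMap_apply]

theorem continuous_dilation_left (x : G) : Continuous (fun r : ℝ => dilation X deg r x) := by
  unfold dilation
  fun_prop

theorem tendsto_dilation (x : G) :
    Tendsto (fun r : ℝ => dilation X deg r x) (𝓝[>] 0) (𝓝 1) := by
  have h := ((hH.continuous_dilation_left x).tendsto 0).mono_left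
    (nhdsWithin_le_nhds (s := Ioi (0 : ℝ)))
  have h0 : dilation X deg 0 x = 1 := by
    rw [hH.one_eq_zero]
    refine X.ext_elem fun j => ?_
    have : deg j ≠ 0 := by have := hH.one_le_deg j; omega
    simp [repr_dilation, this]
  rwa [h0] at h

/-- A homogeneous function of degree `q - p`, continuous at `1`, vanishes if its degree is
negative and is constant if its degree is zero. -/
theorem eq_of_homogeneous {f : G → ℝ} (hf : ContinuousAt f 1) {p q : ℕ}
    (hfd : ∀ r : ℝ, 0 < r → ∀ g, r ^ p * f (dilation X deg r g) = r ^ q * f g) (hqp : q ≤ p)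
    (g : G) : f g = if q = p then f 1 else 0 := by
  have h1 : Tendsto (fun r : ℝ => r ^ (p - q) * f (dilation X deg r g)) (𝓝[>] 0)
      (𝓝 (0 ^ (p - q) * f 1)) :=
    (((continuous_pow (p - q)).tendsto (0 : ℝ)).mono_left nhdsWithin_le_nhds).mul
      (hf.tendsto.comp (hH.tendsto_dilation g))
  have h2 : Tendsto (fun _ : ℝ => f g) (𝓝[>] 0) (𝓝 (0 ^ (p - q) * f 1)) := by
    refine h1.congr' ?_
    filter_upwards [self_mem_nhdsWithin] with r hr
    have hr : 0 < r := hr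
    have h3 := hfd r hr g
    have h4 : r ^ p = r ^ q * r ^ (p - q) := by rw [← pow_add]; congr 1; omega
    rw [h4, mul_assoc] at h3
    exact mul_left_cancel₀ (pow_pos hr q).ne' h3
  rw [tendsto_nhds_unique tendsto_const_nhds h2]
  split_ifs with h
  · simp [h]
  · have : p - q ≠ 0 := by omega
    simp [this]

/-- The coordinates of degree one are additive: `x ↦ X.repr x i` is a homomorphism. -/
theorem repr_mul {i : Fin n} (hi : deg i = 1) (x y : G) :
    X.repr (x * y) i = X.repr x i + X.repr y i := by
  have h1 := hH.one_eq_zero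
  -- The defect `r ↦ (δ_r x * δ_r y - δ_r x - δ_r y)_i` is linear in `r` by homogeneity, and its
  -- derivative at `0` vanishes because the differential of the product at `(1, 1)` is the sum.
  have hm : HasFDerivAt (fun p : G × G => p.1 * p.2)
      (fderiv ℝ (fun p : G × G => p.1 * p.2) (1, 1)) (1, 1) :=
    ((contDiff_mul (G := G)).differentiable (by simp) _).hasFDerivAt
  have hm1 : ∀ v w : G, fderiv ℝ (fun p : G × G => p.1 * p.2) (1, 1) (v, w) = v + w := by
    intro v w
    have c1 : HasFDerivAt (fun y : G => ((1 : G), y)) (ContinuousLinearMap.inr ℝ G G) 1 :=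
      hasFDerivAt_prodMk_right 1 1
    have c2 : HasFDerivAt (fun y : G => (y, (1 : G))) (ContinuousLinearMap.inl ℝ G G) 1 :=
      hasFDerivAt_prodMk_left 1 1
    have d1 := HasFDerivAt.comp (f := fun y : G => ((1 : G), y)) (1 : G) hm c1
    have d2 := HasFDerivAt.comp (f := fun y : G => (y, (1 : G))) (1 : G) hm c2
    have e1 : ((fun p : G × G => p.1 * p.2) ∘ fun y : G => ((1 : G), y)) = id := by
      funext y; simp
    have e2 : ((fun p : G × G => p.1 * p.2) ∘ fun y : G => (y, (1 : G))) = id := by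
      funext y; simp
    rw [e1] at d1
    rw [e2] at d2
    have f1 := congrArg (fun f : G →L[ℝ] G => f w) (d1.unique (hasFDerivAt_id _))
    have f2 := congrArg (fun f : G →L[ℝ] G => f v) (d2.unique (hasFDerivAt_id _))
    simp only [ContinuousLinearMap.comp_apply, ContinuousLinearMap.inr_apply,
      ContinuousLinearMap.inl_apply, ContinuousLinearMap.id_apply] at f1 f2
    have : ((v, w) : G × G) = (v, 0) + (0, w) := by simp
    rw [this, map_add, f1, f2]
  have hdil : ∀ z : G, ∃ z', HasDerivAt (fun r : ℝ => dilation X deg r z) z' 0 := fun z => by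
    have : Differentiable ℝ (fun r : ℝ => dilation X deg r z) := by
      unfold dilation
      fun_prop
    exact ⟨_, (this 0).hasDerivAt⟩
  obtain ⟨x', hx'⟩ := hdil x
  obtain ⟨y', hy'⟩ := hdil y
  have hd0 : ∀ z : G, dilation X deg 0 z = 1 := fun z => by
    rw [h1]
    refine X.ext_elem fun j => ?_
    have : deg j ≠ 0 := by have := hH.one_le_deg j; omega
    simp [repr_dilation, this]
  have hxy : HasDerivAt (fun r : ℝ => dilation X deg r x * dilation X deg r y) (x' + y') 0 := by
    rw [← hm1]
    refine HasFDerivAt.comp_hasDerivAt (l := fun p : G × G => p.1 * p.2)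
      (f := fun r : ℝ => (dilation X deg r x, dilation X deg r y)) (0 : ℝ) ?_ (hx'.prodMk hy')
    simpa only [hd0] using hm
  have hdef := (hxy.sub hx').sub hy'
  let c : G →L[ℝ] ℝ := LinearMap.toContinuousLinearMap (X.coord i)
  have hc := c.hasFDerivAt.comp_hasDerivAt (0 : ℝ) hdef
  have hlin : HasDerivAt (fun r : ℝ => r * c (x * y - x - y)) (c (x * y - x - y)) 0 := by
    simpa using (hasDerivAt_id (0 : ℝ)).mul_const (c (x * y - x - y))
  have hcz : ∀ z, c z = X.repr z i := fun z => rfl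
  have he : (c ∘ (((fun r : ℝ => dilation X deg r x * dilation X deg r y) -
      fun r => dilation X deg r x) - fun r => dilation X deg r y))
      = fun r : ℝ => r * c (x * y - x - y) := by
    funext r
    simp only [Function.comp, Pi.sub_apply, map_sub c, ← hH.dilation_mul, hcz, repr_dilation, hi,
      pow_one]
    ring
  rw [he] at hc
  have h0 := hlin.unique hc
  simp only [add_sub_cancel_left, sub_self, map_sub c, map_zero, hcz, Finsupp.zero_apply] at h0
  linarith

end IsHomogeneousGroup

end Dilations

/-! ### The splitting and the projected fields -/

section Splitting

variable {G : Type*} [NormedAddCommGroup G] [NormedSpace ℝ G] [FiniteDimensional ℝ G]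
  {n : ℕ} {X : Module.Basis (Fin n) ℝ G} {deg : Fin n → ℕ} {k : ℕ}

variable (X k) in
/-- The linear projection of the Lie algebra onto the span of the `X i` with `i < k`. -/
def horizontalPart : G →L[ℝ] G :=
  LinearMap.toContinuousLinearMap
    (X.constr ℝ fun i => if (i : ℕ) < k then X i else 0)

theorem repr_horizontalPart (g : G) (i : Fin n) :
    X.repr (horizontalPart X k g) i = if (i : ℕ) < k then X.repr g i else 0 := by
  have h : horizontalPart X k g = ∑ j : Fin n, (if (j : ℕ) < k then X.repr g j else 0) • X j := by
    change (X.constr ℝ fun i => if (i : ℕ) < k then X i else 0) g = _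
    rw [Module.Basis.constr_apply_fintype]
    refine Finset.sum_congr rfl fun j _ => ?_
    split_ifs <;> simp
  rw [h, X.repr_sum_self]

variable [Group G] {W L : Subgroup G}

theorem IsHorizontalSplitting.mem_W_iff (hWL : IsHorizontalSplitting X deg k W L) {g : G} :
    g ∈ W ↔ ∀ i : Fin n, (i : ℕ) < k → X.repr g i = 0 := by
  rw [← SetLike.mem_coe, hWL.W_eq, SetLike.mem_coe, Module.Basis.mem_span_image]
  constructor
  · intro h i hi
    by_contra h0
    have := h (Finset.mem_coe.2 (Finsupp.mem_support_iff.2 h0))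
    simp only [mem_ofPred_eq] at this
    omega
  · intro h i hi
    have hi := Finsupp.mem_support_iff.1 (Finset.mem_coe.1 hi)
    by_contra h0
    exact hi (h i (by simpa using h0))

theorem IsHorizontalSplitting.mem_L_iff (hWL : IsHorizontalSplitting X deg k W L) {g : G} :
    g ∈ L ↔ ∀ i : Fin n, k ≤ (i : ℕ) → X.repr g i = 0 := by
  rw [← SetLike.mem_coe, hWL.L_eq, SetLike.mem_coe, Module.Basis.mem_span_image]
  constructor
  · intro h i hi
    by_contra h0
    have := h (Finset.mem_coe.2 (Finsupp.mem_support_iff.2 h0))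
    simp only [mem_ofPred_eq] at this
    omega
  · intro h i hi
    have hi := Finsupp.mem_support_iff.1 (Finset.mem_coe.1 hi)
    by_contra h0
    exact hi (h i (by simpa using h0))

theorem IsHorizontalSplitting.horizontalPart_mem (hWL : IsHorizontalSplitting X deg k W L) (g : G) :
    horizontalPart X k g ∈ L :=
  hWL.mem_L_iff.2 fun i hi => by rw [repr_horizontalPart, if_neg (by omega)]

theorem IsHorizontalSplitting.horizontalPart_of_mem_L (hWL : IsHorizontalSplitting X deg k W L)
    {g : G} (hg : g ∈ L) : horizontalPart X k g = g := by
  refine X.ext_elem fun i => ?_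
  rw [repr_horizontalPart]
  split_ifs with h
  · rfl
  · exact (hWL.mem_L_iff.1 hg i (by omega)).symm

variable [LieGroup 𝓘(ℝ, G) ((⊤ : ℕ∞) : WithTop ℕ∞) G]

section
variable (hH : IsHomogeneousGroup X deg) (hWL : IsHorizontalSplitting X deg k W L)
include hH hWL

theorem horizontalPart_eq_one_iff {g : G} : horizontalPart X k g = 1 ↔ g ∈ W := by
  rw [hWL.mem_W_iff, hH.one_eq_zero, X.ext_elem_iff]
  refine forall_congr' fun i => ?_
  rw [repr_horizontalPart]
  simp

theorem mul_eq_add_of_mem_L {x y : G} (hx : x ∈ L) (hy : y ∈ L) : x * y = x + y := by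
  refine X.ext_elem fun i => ?_
  rw [map_add, Finsupp.add_apply]
  by_cases h : (i : ℕ) < k
  · exact hH.repr_mul (hWL.horizontal i h) x y
  · have h : k ≤ (i : ℕ) := by omega
    rw [hWL.mem_L_iff.1 hx i h, hWL.mem_L_iff.1 hy i h, hWL.mem_L_iff.1 (L.mul_mem hx hy) i h,
      add_zero]

theorem horizontalPart_mul (x y : G) :
    horizontalPart X k (x * y) = horizontalPart X k x * horizontalPart X k y := by
  rw [mul_eq_add_of_mem_L hH hWL (hWL.horizontalPart_mem x) (hWL.horizontalPart_mem y)]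
  refine X.ext_elem fun i => ?_
  rw [map_add, Finsupp.add_apply]
  simp only [repr_horizontalPart]
  split_ifs with h
  · exact hH.repr_mul (hWL.horizontal i h) x y
  · rw [add_zero]

theorem horizontalPart_mul_of_mem {w l : G} (hw : w ∈ W) (hl : l ∈ L) :
    horizontalPart X k (w * l) = l := by
  rw [horizontalPart_mul hH hWL, (horizontalPart_eq_one_iff hH hWL).2 hw, one_mul,
    hWL.horizontalPart_of_mem_L hl]

theorem projL_eq (g : G) : (projL hWL.isComplement g : G) = horizontalPart X k g := by
  have h := hWL.isComplement.equiv_fst_mul_equiv_snd g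
  conv_rhs => rw [← h]
  rw [horizontalPart_mul_of_mem hH hWL (hWL.isComplement.equiv g).1.2
    (hWL.isComplement.equiv g).2.2]
  rfl

theorem projW_eq (g : G) : (projW hWL.isComplement g : G) = g * (horizontalPart X k g)⁻¹ := by
  rw [← projL_eq hH hWL, eq_mul_inv_iff_mul_eq]
  exact hWL.isComplement.equiv_fst_mul_equiv_snd g

/-- `W` is normal. -/
theorem conj_mem_W (q : G) {w : G} (hw : w ∈ W) : q * w * q⁻¹ ∈ W := by
  rw [← horizontalPart_eq_one_iff hH hWL, horizontalPart_mul hH hWL, horizontalPart_mul hH hWL,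
    (horizontalPart_eq_one_iff hH hWL).2 hw, mul_one, ← horizontalPart_mul hH hWL, mul_inv_cancel,
    horizontalPart_eq_one_iff hH hWL]
  exact W.one_mem

end

variable (X k) in
/-- The projection `π_W`, as a map `G → G`. -/
def wPart (g : G) : G := g * (horizontalPart X k g)⁻¹

variable (X k) in
/-- The action of `q` on `W` for which `π_W` is equivariant:
`π_W (q * g) = wTranslate q (π_W g)`. -/
def wTranslate (q g : G) : G := q * g * (horizontalPart X k q)⁻¹

variable (X k) in
/-- The field `g ↦ d(π_W)_g (x|_g)`, for the left-invariant field `x`. -/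
def projField (x g : G) : G := fderiv ℝ (wPart X k) g (leftDeriv g x)

theorem contDiff_wPart : ContDiff ℝ ((⊤ : ℕ∞) : WithTop ℕ∞) (wPart X k) :=
  contDiff_fun_mul contDiff_id (contDiff_inv.comp (horizontalPart X k).contDiff)

theorem contDiff_wTranslate (q : G) : ContDiff ℝ ((⊤ : ℕ∞) : WithTop ℕ∞) (wTranslate X k q) :=
  contDiff_fun_mul (contDiff_const_mul q) contDiff_const

theorem continuous_projField (x : G) : Continuous (projField X k x) := by
  have h1 : Continuous (fderiv ℝ (wPart X k)) := contDiff_wPart.continuous_fderiv (by simp)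
  exact h1.clm_apply (contDiff_leftDeriv.continuous.clm_apply continuous_const)

section
variable (hH : IsHomogeneousGroup X deg) (hWL : IsHorizontalSplitting X deg k W L)
include hH hWL

theorem projectedField_eq (φ : W → L) (x : G) (w : W) :
    projectedField hWL.isComplement φ x w = projField X k x ((w : G) * (φ w : G)) := by
  have h : (fun g : G => (projW hWL.isComplement g : G)) = wPart X k :=
    funext fun g => projW_eq hH hWL g
  unfold projectedField
  rw [h]
  rfl

theorem wPart_mul_of_mem {w l : G} (hw : w ∈ W) (hl : l ∈ L) : wPart X k (w * l) = w := by
  unfold wPart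
  rw [horizontalPart_mul_of_mem hH hWL hw hl, mul_inv_cancel_right]

theorem wPart_mul (q g : G) : wPart X k (q * g) = wTranslate X k q (wPart X k g) := by
  unfold wPart wTranslate
  rw [horizontalPart_mul hH hWL]
  group

theorem wTranslate_mem (q : G) {g : G} (hg : g ∈ W) : wTranslate X k q g ∈ W := by
  rw [← horizontalPart_eq_one_iff hH hWL]
  unfold wTranslate
  rw [horizontalPart_mul hH hWL, horizontalPart_mul hH hWL,
    (horizontalPart_eq_one_iff hH hWL).2 hg, mul_one, ← horizontalPart_mul hH hWL]
  have h : horizontalPart X k (q * (horizontalPart X k q)⁻¹) = 1 := by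
    rw [horizontalPart_mul hH hWL,
      hWL.horizontalPart_of_mem_L (L.inv_mem (hWL.horizontalPart_mem q)), mul_inv_cancel]
  exact h

theorem wTranslate_of_mem {w : G} (hw : w ∈ W) (g : G) : wTranslate X k w g = w * g := by
  unfold wTranslate
  rw [(horizontalPart_eq_one_iff hH hWL).2 hw]
  simp

/-- The projected field is equivariant under left translations. -/
theorem fderiv_wTranslate_projField (q x g : G) :
    fderiv ℝ (wTranslate X k q) (wPart X k g) (projField X k x g) = projField X k x (q * g) := by
  have h : wPart X k ∘ (fun y => q * y) = wTranslate X k q ∘ wPart X k :=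
    funext fun y => wPart_mul hH hWL q y
  have dw : Differentiable ℝ (wPart X k) := contDiff_wPart.differentiable (by simp)
  have dt : Differentiable ℝ (wTranslate X k q) := (contDiff_wTranslate q).differentiable (by simp)
  have h1 := congrArg (fun f : G → G => fderiv ℝ f g (leftDeriv g x)) h
  beta_reduce at h1
  rw [fderiv_comp g (dw _) (differentiable_const_mul q _), fderiv_comp g (dt _) (dw _)] at h1
  simp only [ContinuousLinearMap.comp_apply, fderiv_const_mul_leftDeriv] at h1
  exact h1.symm

/-- Integral curves of the projected fields are mapped to such curves by `wTranslate`. -/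
theorem hasDerivWithinAt_wTranslate {γ η : ℝ → G} {σ t : ℝ} {S : Set ℝ} {x : G} (q : G)
    (hγ : γ t ∈ W) (hη : η t ∈ L)
    (h : HasDerivWithinAt γ (σ • projField X k x (γ t * η t)) S t) :
    HasDerivWithinAt (fun t => wTranslate X k q (γ t)) (σ • projField X k x (q * (γ t * η t)))
      S t := by
  have dt : HasFDerivAt (wTranslate X k q) (fderiv ℝ (wTranslate X k q) (γ t)) (γ t) :=
    ((contDiff_wTranslate q).differentiable (by simp) _).hasFDerivAt
  have h1 := dt.comp_hasDerivWithinAt t h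
  have h2 := fderiv_wTranslate_projField hH hWL q x (γ t * η t)
  rw [wPart_mul_of_mem hH hWL hγ hη] at h2
  rw [map_smul, h2] at h1
  exact h1

theorem dilation_horizontalPart (r : ℝ) (g : G) :
    horizontalPart X k (dilation X deg r g) = dilation X deg r (horizontalPart X k g) := by
  refine X.ext_elem fun i => ?_
  simp only [repr_horizontalPart, repr_dilation]
  split_ifs <;> simp

theorem dilation_wPart (r : ℝ) (g : G) :
    wPart X k (dilation X deg r g) = dilation X deg r (wPart X k g) := by
  unfold wPart
  rw [hH.dilation_mul, hH.dilation_inv, dilation_horizontalPart hH hWL]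

omit hWL in
theorem dilation_leftDeriv (r : ℝ) (g x : G) :
    dilation X deg r (leftDeriv g x) = leftDeriv (dilation X deg r g) (dilation X deg r x) := by
  have h : dilationMap X deg r ∘ (fun y => g * y)
      = (fun y => dilation X deg r g * y) ∘ dilationMap X deg r :=
    funext fun y => hH.dilation_mul r g y
  have h1 := congrArg (fun f : G → G => fderiv ℝ f 1 x) h
  beta_reduce at h1
  rw [fderiv_comp 1 (dilationMap X deg r).differentiableAt (differentiable_const_mul g _),
    fderiv_comp 1 (differentiable_const_mul _ _) (dilationMap X deg r).differentiableAt] at h1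
  simp only [ContinuousLinearMap.comp_apply, ContinuousLinearMap.fderiv, dilationMap_apply,
    hH.dilation_one] at h1
  exact h1

/-- The projected field of `X j` is homogeneous of degree `-deg j`. -/
theorem dilation_projField (r : ℝ) (j : Fin n) (g : G) :
    dilation X deg r (projField X k (X j) g)
      = r ^ deg j • projField X k (X j) (dilation X deg r g) := by
  have h : wPart X k ∘ dilationMap X deg r = dilationMap X deg r ∘ wPart X k :=
    funext fun y => dilation_wPart hH hWL r y
  have dw : Differentiable ℝ (wPart X k) := contDiff_wPart.differentiable (by simp)
  have h1 := congrArg (fun f : G → G => fderiv ℝ f g (leftDeriv g (X j))) h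
  beta_reduce at h1
  rw [fderiv_comp g (dw _) (dilationMap X deg r).differentiableAt,
    fderiv_comp g (dilationMap X deg r).differentiableAt (dw _)] at h1
  simp only [ContinuousLinearMap.comp_apply, ContinuousLinearMap.fderiv, dilationMap_apply,
    dilation_leftDeriv hH, dilation_basis, map_smul] at h1
  exact h1.symm

theorem projField_one {j : Fin n} (hj : k ≤ (j : ℕ)) : projField X k (X j) 1 = X j := by
  have h1 := hH.one_eq_zero
  unfold projField
  rw [leftDeriv_one]
  have dw : HasFDerivAt (wPart X k) (fderiv ℝ (wPart X k) 1) ((0 : ℝ) • X j) := by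
    rw [zero_smul, ← h1]
    exact (contDiff_wPart.differentiable (by simp) _).hasFDerivAt
  have hs : HasDerivAt (fun t : ℝ => t • X j) (X j) 0 := by
    simpa using (hasDerivAt_id (0 : ℝ)).smul_const (X j)
  have h2 := dw.comp_hasDerivAt (0 : ℝ) hs
  have h3 : (wPart X k ∘ fun t : ℝ => t • X j) = fun t : ℝ => t • X j := by
    funext t
    have hm : t • X j ∈ W := hWL.mem_W_iff.2 fun i hi => by
      have : j ≠ i := by rintro rfl; omega
      simp [this]
    simpa using wPart_mul_of_mem hH hWL hm L.one_mem
  rw [h3] at h2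
  exact h2.unique hs

/-- The projected field of `X j` is triangular: its components of degree at most `deg j` are
constant. -/
theorem repr_projField {i j : Fin n} (hj : k ≤ (j : ℕ)) (hij : deg i ≤ deg j) (g : G) :
    X.repr (projField X k (X j) g) i = if i = j then 1 else 0 := by
  have hc : Continuous (fun g => X.repr (projField X k (X j) g) i) :=
    (LinearMap.toContinuousLinearMap (X.coord i)).continuous.comp (continuous_projField (X j))
  rw [hH.eq_of_homogeneous (f := fun g => X.repr (projField X k (X j) g) i) hc.continuousAt
    (p := deg j) (q := deg i) (fun r _ g => ?_) hij g]
  · rw [projField_one hH hWL hj]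
    simp only [Module.Basis.repr_self, Finsupp.single_apply]
    by_cases h : i = j
    · simp [h]
    · simp [h, Ne.symm h]
  · have := congrArg (fun v => X.repr v i) (dilation_projField hH hWL r j g)
    simp only [repr_dilation, map_smul, Finsupp.smul_apply, smul_eq_mul] at this
    exact this.symm

end

end Splitting

/-! ### Homogeneous norms and distances -/

section Norms

variable {G : Type*} [NormedAddCommGroup G] [NormedSpace ℝ G] [FiniteDimensional ℝ G]
  {n : ℕ} {X : Module.Basis (Fin n) ℝ G} {deg : Fin n → ℕ}

theorem continuous_repr (i : Fin n) : Continuous (fun g : G => X.repr g i) :=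
  (LinearMap.toContinuousLinearMap (X.coord i)).continuous

theorem norm_le_sum_repr (g : G) : ‖g‖ ≤ ∑ i, |X.repr g i| * ‖X i‖ := by
  conv_lhs => rw [← X.sum_repr g]
  refine (norm_sum_le _ _).trans (Finset.sum_le_sum fun i _ => ?_)
  rw [norm_smul, Real.norm_eq_abs]

variable (X deg) in
/-- An explicit homogeneous gauge, `∑ i, |x_i| ^ (1 / deg i)`. -/
def homGauge (g : G) : ℝ := ∑ i, |X.repr g i| ^ (1 / (deg i : ℝ))

theorem homGauge_nonneg (g : G) : 0 ≤ homGauge X deg g :=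
  Finset.sum_nonneg fun _ _ => Real.rpow_nonneg (abs_nonneg _) _

theorem continuous_homGauge : Continuous (homGauge X deg) := by
  refine continuous_finsetSum _ fun i _ => ?_
  exact (continuous_repr i).abs.rpow_const fun _ => Or.inr (by positivity)

theorem pow_rpow_one_div {x : ℝ} (hx : 0 ≤ x) {p : ℕ} (hp : 1 ≤ p) :
    (x ^ p) ^ (1 / (p : ℝ)) = x := by
  rw [one_div, Real.pow_rpow_inv_natCast hx (by omega)]

variable [Group G]

theorem abs_repr_le_homGauge_pow (hdeg : ∀ i, 1 ≤ deg i) (g : G) (i : Fin n) :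
    |X.repr g i| ≤ homGauge X deg g ^ deg i := by
  have h : |X.repr g i| ^ (1 / (deg i : ℝ)) ≤ homGauge X deg g :=
    Finset.single_le_sum (f := fun i => |X.repr g i| ^ (1 / (deg i : ℝ)))
      (fun _ _ => Real.rpow_nonneg (abs_nonneg _) _) (Finset.mem_univ i)
  have h2 := pow_le_pow_left₀ (Real.rpow_nonneg (abs_nonneg _) _) h (deg i)
  rwa [one_div, Real.rpow_inv_natCast_pow (abs_nonneg _) (by have := hdeg i; omega)] at h2

theorem homGauge_dilation (hdeg : ∀ i, 1 ≤ deg i) {r : ℝ} (hr : 0 < r) (g : G) :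
    homGauge X deg (dilation X deg r g) = r * homGauge X deg g := by
  unfold homGauge
  rw [Finset.mul_sum]
  refine Finset.sum_congr rfl fun i _ => ?_
  rw [repr_dilation, abs_mul, abs_of_pos (pow_pos hr _),
    Real.mul_rpow (by positivity) (abs_nonneg _), pow_rpow_one_div hr.le (hdeg i)]

theorem isCompact_homGauge_le (hdeg : ∀ i, 1 ≤ deg i) (r : ℝ) :
    IsCompact {g | homGauge X deg g ≤ r} := by
  refine Metric.isCompact_of_isClosed_isBounded
    (isClosed_le continuous_homGauge continuous_const) ?_
  refine (Metric.isBounded_closedBall (x := (0 : G)) (r := ∑ i, r ^ deg i * ‖X i‖)).subset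
    fun g hg => ?_
  rw [mem_closedBall_zero_iff]
  refine (norm_le_sum_repr (X := X) g).trans (Finset.sum_le_sum fun i _ => ?_)
  gcongr
  exact (abs_repr_le_homGauge_pow hdeg g i).trans (pow_le_pow_left₀ (homGauge_nonneg g) hg _)

variable [LieGroup 𝓘(ℝ, G) ((⊤ : ℕ∞) : WithTop ℕ∞) G]

theorem homGauge_pos (hH : IsHomogeneousGroup X deg) {g : G} (hg : g ≠ 1) :
    0 < homGauge X deg g := by
  refine (homGauge_nonneg g).lt_of_ne fun h => hg ?_
  rw [hH.one_eq_zero]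
  refine X.ext_elem fun i => ?_
  have h1 := abs_repr_le_homGauge_pow (X := X) hH.one_le_deg g i
  rw [← h, zero_pow (by have := hH.one_le_deg i; omega)] at h1
  simpa using h1

/-- A continuous homogeneous function is controlled by any positive one. -/
theorem exists_abs_le_of_homogeneous (hH : IsHomogeneousGroup X deg) {ρ f : G → ℝ}
    (hρ : Continuous ρ) (hρ_pos : ∀ g, g ≠ 1 → 0 < ρ g) (hρ_one : ρ 1 = 0)
    (hρ_dil : ∀ r : ℝ, 0 < r → ∀ g, ρ (dilation X deg r g) = r * ρ g)
    (hf : Continuous f) {p : ℕ} (hp : 1 ≤ p)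
    (hf_dil : ∀ r : ℝ, 0 < r → ∀ g, f (dilation X deg r g) = r ^ p * f g) :
    ∃ C > 0, ∀ g, |f g| ≤ C * ρ g ^ p := by
  set S : Set G := {g | homGauge X deg g = 1} with hS
  have hSc : IsCompact S := (isCompact_homGauge_le hH.one_le_deg 1).of_isClosed_subset
    (isClosed_eq continuous_homGauge continuous_const) fun g hg => le_of_eq hg
  have hS1 : ∀ g ∈ S, g ≠ 1 := by
    rintro g hg rfl
    have h := homGauge_dilation (X := X) hH.one_le_deg two_pos (1 : G)
    rw [hH.dilation_one, show homGauge X deg (1 : G) = 1 from hg] at h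
    norm_num at h
  obtain ⟨c, hc, hcS⟩ := hSc.exists_forall_le' (f := ρ) (a := 0) hρ.continuousOn
    fun g hg => hρ_pos g (hS1 g hg)
  obtain ⟨M, hM⟩ := hSc.exists_bound_of_continuousOn hf.continuousOn
  refine ⟨(|M| + 1) / c ^ p, by positivity, fun g => ?_⟩
  by_cases hg : g = 1
  · have h := hf_dil 2 two_pos 1
    rw [hH.dilation_one] at h
    have h2 : (1 : ℝ) < 2 ^ p := one_lt_pow₀ (by norm_num) (by omega)
    have h3 : f 1 = 0 := by
      by_contra h0
      exact h2.ne (mul_right_cancel₀ h0 (by rw [one_mul]; exact h))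
    rw [hg, h3, hρ_one, abs_zero, zero_pow (by omega), mul_zero]
  · have hm := homGauge_pos hH hg
    set m := homGauge X deg g
    have hS' : dilation X deg m⁻¹ g ∈ S := by
      rw [hS, mem_ofPred_eq, homGauge_dilation hH.one_le_deg (by positivity),
        inv_mul_cancel₀ hm.ne']
    have h1 := hM _ hS'
    have h2 := hcS _ hS'
    rw [hf_dil _ (by positivity), Real.norm_eq_abs, abs_mul, abs_of_pos (by positivity), inv_pow,
      inv_mul_le_iff₀ (by positivity)] at h1
    rw [hρ_dil _ (by positivity), le_inv_mul_iff₀ hm] at h2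
    calc |f g| ≤ m ^ p * M := h1
      _ ≤ m ^ p * (|M| + 1) := by gcongr; linarith [le_abs_self M]
      _ = (|M| + 1) / c ^ p * (m * c) ^ p := by rw [mul_pow]; field_simp
      _ ≤ _ := by gcongr

section
variable {d : G → G → ℝ} (hd : IsHomogeneousDistance X deg d)
include hd

theorem IsHomogeneousDistance.nonneg (x y : G) : 0 ≤ d x y := by
  have h := hd.triangle x y x
  rw [(hd.eq_zero_iff x x).2 rfl, hd.symm y x] at h
  linarith

theorem IsHomogeneousDistance.eq_one_inv_mul (x y : G) : d x y = d 1 (x⁻¹ * y) := by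
  rw [← hd.mul_left x⁻¹ x y, inv_mul_cancel]

theorem IsHomogeneousDistance.one_mul_le (x y : G) : d 1 (x * y) ≤ d 1 x + d 1 y := by
  refine (hd.triangle 1 x (x * y)).trans (le_of_eq ?_)
  rw [hd.eq_one_inv_mul x, inv_mul_cancel_left]

theorem IsHomogeneousDistance.one_inv (x : G) : d 1 x⁻¹ = d 1 x := by
  rw [hd.symm, hd.eq_one_inv_mul, inv_inv, mul_one]

theorem IsHomogeneousDistance.one_pos {x : G} (hx : x ≠ 1) : 0 < d 1 x :=
  (hd.nonneg 1 x).lt_of_ne fun h => hx ((hd.eq_zero_iff 1 x).1 h.symm).symm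

theorem IsHomogeneousDistance.continuous_one : Continuous (d 1) :=
  hd.continuous.comp (continuous_const.prodMk continuous_id)

variable (hH : IsHomogeneousGroup X deg)
include hH

theorem IsHomogeneousDistance.one_dilation {r : ℝ} (hr : 0 < r) (x : G) :
    d 1 (Carnot.dilation X deg r x) = r * d 1 x := by
  conv_lhs => rw [← hH.dilation_one r]
  exact hd.dilation r hr 1 x

theorem exists_abs_repr_le : ∃ C > 0, ∀ (g : G) (i : Fin n), |X.repr g i| ≤ C * d 1 g ^ deg i := by
  have h : ∀ i, ∃ C > 0, ∀ g : G, |X.repr g i| ≤ C * d 1 g ^ deg i := fun i =>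
    exists_abs_le_of_homogeneous hH hd.continuous_one (fun g hg => hd.one_pos hg)
      ((hd.eq_zero_iff _ _).2 rfl) (fun r hr g => hd.one_dilation hH hr g) (continuous_repr i)
      (hH.one_le_deg i) fun r _ g => repr_dilation r g i
  choose C hC0 hC using h
  refine ⟨∑ i, C i + 1, ?_, fun g i => ?_⟩
  · have := Finset.sum_nonneg (s := Finset.univ) fun i _ => (hC0 i).le
    linarith
  · refine (hC i g).trans (mul_le_mul_of_nonneg_right ?_ (pow_nonneg (hd.nonneg _ _) _))
    have := Finset.single_le_sum (f := C) (fun i _ => (hC0 i).le) (Finset.mem_univ i)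
    linarith

theorem exists_dist_le_homGauge : ∃ C > 0, ∀ g : G, d 1 g ≤ C * homGauge X deg g := by
  have h1 : homGauge X deg (1 : G) = 0 := by
    have h := homGauge_dilation (X := X) hH.one_le_deg two_pos (1 : G)
    rw [hH.dilation_one] at h
    linarith
  obtain ⟨C, hC, h⟩ := exists_abs_le_of_homogeneous hH (f := d 1) (p := 1)
    (continuous_homGauge (X := X) (deg := deg))
    (fun g hg => homGauge_pos hH hg) h1 (fun r hr g => homGauge_dilation hH.one_le_deg hr g)
    hd.continuous_one le_rfl fun r hr g => by rw [pow_one, hd.one_dilation hH hr]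
  exact ⟨C, hC, fun g => by simpa using (le_abs_self _).trans (h g)⟩

theorem exists_norm_le_dist : ∃ C > 0, ∀ g : G, d 1 g ≤ 1 → ‖g‖ ≤ C * d 1 g := by
  obtain ⟨C, hC, h⟩ := exists_abs_repr_le hd hH
  refine ⟨∑ i, C * ‖X i‖ + 1, by positivity, fun g hg => ?_⟩
  have h0 := hd.nonneg 1 g
  calc ‖g‖ ≤ ∑ i, |X.repr g i| * ‖X i‖ := norm_le_sum_repr g
    _ ≤ ∑ i, C * ‖X i‖ * d 1 g := by
      refine Finset.sum_le_sum fun i _ => ?_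
      have h1 : d 1 g ^ deg i ≤ d 1 g :=
        pow_le_of_le_one h0 hg (by have := hH.one_le_deg i; omega)
      calc |X.repr g i| * ‖X i‖ ≤ C * d 1 g ^ deg i * ‖X i‖ := by gcongr; exact h g i
        _ ≤ C * d 1 g * ‖X i‖ := by gcongr
        _ = _ := by ring
    _ = (∑ i, C * ‖X i‖) * d 1 g := by rw [Finset.sum_mul]
    _ ≤ _ := by gcongr; linarith

/-- A homogeneous distance induces a topology at least as fine as that of `G`. -/
theorem exists_ball_subset {x : G} {O : Set G} (hO : O ∈ 𝓝 x) :
    ∃ r > 0, ∀ y, d x y < r → y ∈ O := by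
  obtain ⟨C, hC, h⟩ := exists_norm_le_dist hd hH
  have hc : ContinuousAt (fun y : G => x * y) 0 :=
    (differentiable_const_mul x).continuous.continuousAt
  have h1 : (fun y : G => x * y) 0 = x := by
    simp only [← hH.one_eq_zero, mul_one]
  rw [← h1] at hO
  obtain ⟨ε, hε, hεO⟩ := Metric.mem_nhds_iff.1 (hc hO)
  refine ⟨min 1 (ε / C), by positivity, fun y hy => ?_⟩
  rw [hd.eq_one_inv_mul] at hy
  have h2 := h _ (hy.le.trans (min_le_left _ _))
  have h3 : C * d 1 (x⁻¹ * y) < ε := by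
    rw [mul_comm]; exact (lt_div_iff₀ hC).1 (hy.trans_le (min_le_right _ _))
  have h4 : x⁻¹ * y ∈ Metric.ball (0 : G) ε := by
    rw [mem_ball_zero_iff]; exact h2.trans_lt h3
  have h5 := hεO h4
  simpa using h5

end

theorem isCompact_dist_le {d : G → G → ℝ} (hd : IsHomogeneousDistance X deg d)
    (hH : IsHomogeneousGroup X deg) : IsCompact {g | d 1 g ≤ 1} := by
  obtain ⟨C, hC, h⟩ := exists_norm_le_dist hd hH
  refine Metric.isCompact_of_isClosed_isBounded (isClosed_le hd.continuous_one continuous_const) ?_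
  refine (Metric.isBounded_closedBall (x := (0 : G)) (r := C)).subset fun g hg => ?_
  rw [mem_closedBall_zero_iff]
  refine (h g hg).trans ?_
  have : d 1 g ≤ 1 := hg
  nlinarith

end Norms

/-! ### Integral curves of the projected fields -/

section Curves

/-- A curve cannot leave a ball, around its starting point, in which its speed is controlled
before the corresponding time. -/
theorem norm_sub_le_of_speed_lt {E : Type*} [NormedAddCommGroup E] [NormedSpace ℝ E] {f f' : ℝ → E}
    {T M : ℝ} (hf : ∀ t ∈ Icc 0 T, HasDerivWithinAt f (f' t) (Icc 0 T) t) (hM : 0 ≤ M)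
    (hf' : ∀ t ∈ Icc 0 T, ‖f t - f 0‖ ≤ M * T → ‖f' t‖ < M) :
    ∀ t ∈ Icc 0 T, ‖f t - f 0‖ ≤ M * t := by
  intro t ht
  refine image_norm_le_of_norm_deriv_right_lt_deriv_boundary' (f := fun t => f t - f 0) (f' := f')
    (a := 0) (b := T) (B := fun t => M * t) (B' := fun _ => M) ?_ ?_ (by simp) (by fun_prop)
    ?_ ?_ ht
  · exact ContinuousOn.sub (fun s hs => (hf s hs).continuousWithinAt) continuousOn_const
  · intro s hs
    exact ((hf s ⟨hs.1, hs.2.le⟩).mono_of_mem_nhdsWithin (Icc_mem_nhdsGE_of_mem hs)).sub_const _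
  · intro s _
    simpa using ((hasDerivAt_id s).const_mul M).hasDerivWithinAt
  · intro s hs h
    refine hf' s ⟨hs.1, hs.2.le⟩ ?_
    rw [h]
    exact mul_le_mul_of_nonneg_left hs.2.le hM

variable {G : Type*} [NormedAddCommGroup G] [NormedSpace ℝ G] [FiniteDimensional ℝ G]
  [Group G] [LieGroup 𝓘(ℝ, G) ((⊤ : ℕ∞) : WithTop ℕ∞) G]
  {n : ℕ} {X : Module.Basis (Fin n) ℝ G} {deg : Fin n → ℕ} {k : ℕ} {W L : Subgroup G}

/-- Along a curve `γ' = σ • projField (X j) (γ * η)`, the coordinates of degree at most `deg j`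
are constant, except for the `j`-th one, which has speed `σ`. -/
theorem repr_eq_of_curve (hH : IsHomogeneousGroup X deg) (hWL : IsHorizontalSplitting X deg k W L)
    {j : Fin n} (hj : k ≤ (j : ℕ)) {σ T : ℝ} {γ η : ℝ → G}
    (hγ : ∀ t ∈ Icc 0 T, HasDerivWithinAt γ (σ • projField X k (X j) (γ t * η t)) (Icc 0 T) t)
    {i : Fin n} (hij : deg i ≤ deg j) {t : ℝ} (ht : t ∈ Icc 0 T) :
    X.repr (γ t) i = X.repr (γ 0) i + if i = j then σ * t else 0 := by
  set c : ℝ := if i = j then 1 else 0 with hc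
  have h1 : ∀ t ∈ Icc 0 T,
      HasDerivWithinAt (fun t => X.repr (γ t) i - σ * c * t) 0 (Icc 0 T) t := by
    intro t ht
    have h2 := (LinearMap.toContinuousLinearMap (X.coord i)).hasFDerivAt.comp_hasDerivWithinAt t
      (hγ t ht)
    have h3 : (LinearMap.toContinuousLinearMap (X.coord i))
        (σ • projField X k (X j) (γ t * η t)) = σ * c := by
      rw [map_smul, smul_eq_mul]
      exact congrArg (σ * ·) (repr_projField hH hWL hj hij (γ t * η t))
    rw [h3] at h2
    have h4 : HasDerivWithinAt (fun t => σ * c * t) (σ * c) (Icc 0 T) t := by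
      simpa using ((hasDerivAt_id t).const_mul (σ * c)).hasDerivWithinAt
    simpa using HasDerivWithinAt.fun_sub h2 h4
  have h5 := (convex_Icc (0 : ℝ) T).norm_image_sub_le_of_norm_hasDerivWithin_le (C := 0) h1
    (by simp) (left_mem_Icc.2 (ht.1.trans ht.2)) ht
  rw [zero_mul, norm_le_zero_iff, sub_eq_zero] at h5
  have h6 : σ * c * t = if i = j then σ * t else 0 := by
    rw [hc]; split_ifs <;> ring
  rw [← h6]
  linarith

/-- A curve `γ' = σ • projField (X j) (γ * η)` with `η` of size at most `R` moves by at most a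
multiple of `R` in a time at most a multiple of `R ^ deg j`: by homogeneity and left invariance,
it is enough to bound the speed near the identity when `R = 1`. -/
theorem exists_dist_le_of_curve (hH : IsHomogeneousGroup X deg)
    (hWL : IsHorizontalSplitting X deg k W L) {d : G → G → ℝ}
    (hd : IsHomogeneousDistance X deg d) (j : Fin n) :
    ∃ τ > 0, ∃ C > 0, ∀ R > 0, ∀ T, 0 ≤ T → T ≤ τ * R ^ deg j → ∀ σ : ℝ, |σ| ≤ 1 →
      ∀ γ η : ℝ → G, (∀ t ∈ Icc 0 T, γ t ∈ W ∧ η t ∈ L ∧ d 1 (η t) ≤ R ∧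
        HasDerivWithinAt γ (σ • projField X k (X j) (γ t * η t)) (Icc 0 T) t) →
      ∀ t ∈ Icc 0 T, d 1 ((γ 0)⁻¹ * γ t) ≤ C * R := by
  have hcomp : IsCompact (Metric.closedBall (0 : G) 1 ×ˢ {g : G | d 1 g ≤ 1}) :=
    (isCompact_closedBall _ _).prod (isCompact_dist_le hd hH)
  have hcont : Continuous (fun p : G × G => projField X k (X j) (p.1 * p.2)) :=
    (continuous_projField (X j)).comp (contDiff_mul (G := G)).continuous
  obtain ⟨M, hM⟩ := hcomp.exists_bound_of_continuousOn hcont.continuousOn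
  obtain ⟨C, hC⟩ := (isCompact_closedBall (0 : G) 1).exists_bound_of_continuousOn
    hd.continuous_one.continuousOn
  refine ⟨(|M| + 1)⁻¹, by positivity, |C| + 1, by positivity, ?_⟩
  intro R hR T hT hTR σ hσ γ η h t ht
  have h1 := hH.one_eq_zero
  set y : ℝ → G := fun t => dilation X deg R⁻¹ ((γ 0)⁻¹ * γ t) with hy
  have h0mem : (0 : ℝ) ∈ Icc 0 T := left_mem_Icc.2 hT
  have hw : (γ 0)⁻¹ ∈ W := W.inv_mem (h 0 h0mem).1
  have hy0 : y 0 = 0 := by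
    rw [hy]; beta_reduce; rw [inv_mul_cancel, hH.dilation_one, h1]
  have hyd : ∀ t ∈ Icc 0 T, HasDerivWithinAt y
      ((σ * (R⁻¹) ^ deg j) • projField X k (X j) (y t * dilation X deg R⁻¹ (η t))) (Icc 0 T) t := by
    intro t ht
    obtain ⟨hγ, hη, _, hder⟩ := h t ht
    have e1 := hasDerivWithinAt_wTranslate hH hWL (γ 0)⁻¹ hγ hη hder
    have e2 := (dilationMap X deg R⁻¹).hasFDerivAt.comp_hasDerivWithinAt t e1
    have e3 : (dilationMap X deg R⁻¹ ∘ fun t => wTranslate X k (γ 0)⁻¹ (γ t)) = y := by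
      funext t
      simp only [Function.comp, wTranslate_of_mem hH hWL hw, hy, dilationMap_apply]
    rw [e3, map_smul, dilationMap_apply, dilation_projField hH hWL, ← mul_assoc,
      hH.dilation_mul, smul_smul] at e2
    exact e2
  have hB : (|M| + 1) * R⁻¹ ^ deg j * T ≤ 1 := by
    rw [inv_pow]
    have : T ≤ R ^ deg j / (|M| + 1) := by rw [div_eq_inv_mul]; exact hTR
    rw [le_div_iff₀ (by positivity)] at this
    rw [mul_comm _ T, ← mul_assoc, ← div_eq_mul_inv, div_le_one (by positivity)]
    exact this
  have hmain := norm_sub_le_of_speed_lt hyd (M := (|M| + 1) * R⁻¹ ^ deg j) (by positivity)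
    (fun t ht hle => by
      obtain ⟨_, _, hηR, _⟩ := h t ht
      rw [hy0, sub_zero] at hle
      have hmem : (y t, dilation X deg R⁻¹ (η t)) ∈
          Metric.closedBall (0 : G) 1 ×ˢ {g : G | d 1 g ≤ 1} := by
        refine ⟨mem_closedBall_zero_iff.2 (hle.trans hB), ?_⟩
        rw [mem_ofPred_eq, hd.one_dilation hH (by positivity), inv_mul_le_iff₀ hR, mul_one]
        exact hηR
      have hb := hM _ hmem
      have hp : 0 < R⁻¹ ^ deg j := by positivity
      rw [norm_smul, norm_mul, Real.norm_eq_abs, Real.norm_of_nonneg hp.le]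
      have hb' : ‖projField X k (X j) (y t * dilation X deg R⁻¹ (η t))‖ < |M| + 1 := by
        have := le_abs_self M
        exact lt_of_le_of_lt hb (by linarith)
      calc |σ| * R⁻¹ ^ deg j * ‖projField X k (X j) (y t * dilation X deg R⁻¹ (η t))‖
          ≤ 1 * R⁻¹ ^ deg j * ‖projField X k (X j) (y t * dilation X deg R⁻¹ (η t))‖ := by gcongr
        _ < 1 * R⁻¹ ^ deg j * (|M| + 1) := by gcongr
        _ = _ := by ring) t ht
  rw [hy0, sub_zero] at hmain
  have hy1 : ‖y t‖ ≤ 1 := hmain.trans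
    ((mul_le_mul_of_nonneg_left ht.2 (by positivity)).trans hB)
  have hc := hC (y t) (mem_closedBall_zero_iff.2 hy1)
  rw [hy] at hc
  simp only at hc
  rw [hd.one_dilation hH (by positivity), Real.norm_eq_abs] at hc
  have h3 := (le_abs_self _).trans hc
  rw [inv_mul_le_iff₀ hR] at h3
  have := le_abs_self C
  nlinarith

theorem IsProjectedCurve.mono {h : Subgroup.IsComplement' W L} {φ : W → L} {x : G} {T T' : ℝ}
    {a : W} {γ : ℝ → W} (hγ : IsProjectedCurve h φ x T a γ) (hT : T' ≤ T) :
    IsProjectedCurve h φ x T' a γ := by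
  have hs : Icc (-T') T' ⊆ Icc (-T) T := Icc_subset_Icc (by linarith) hT
  exact ⟨hγ.1.mono hs, fun t ht => (hγ.2.1 t (hs ht)).mono hs, hγ.2.2⟩

theorem IsProjectedCurve.continuousOn {h : Subgroup.IsComplement' W L} {φ : W → L} {x : G} {T : ℝ}
    {a : W} {γ : ℝ → W} (hγ : IsProjectedCurve h φ x T a γ) : ContinuousOn γ (Icc (-T) T) :=
  Topology.IsInducing.subtypeVal.continuousOn_iff.2 hγ.1.continuousOn

/-- Both halves of a curve on `[-T, T]`, reparametrized on `[0, T']`. -/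
theorem IsProjectedCurve.hasDerivWithinAt_mul (hH : IsHomogeneousGroup X deg)
    (hWL : IsHorizontalSplitting X deg k W L) {φ : W → L} {x : G} {T T' : ℝ} {a : W} {γ : ℝ → W}
    (hγ : IsProjectedCurve hWL.isComplement φ x T a γ) (hT : T' ≤ T) {σ : ℝ} (hσ : |σ| ≤ 1)
    {t : ℝ} (ht : t ∈ Icc 0 T') :
    HasDerivWithinAt (fun t => (γ (σ * t) : G))
      (σ • projField X k x ((γ (σ * t) : G) * (φ (γ (σ * t)) : G))) (Icc 0 T') t := by
  have hmaps : MapsTo (fun t => σ * t) (Icc 0 T') (Icc (-T) T) := by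
    intro s hs
    rw [mem_Icc, ← abs_le, abs_mul, abs_of_nonneg hs.1]
    calc |σ| * s ≤ 1 * s := by gcongr; exact hs.1
      _ ≤ T := by linarith [hs.2]
  have h1 := hγ.2.1 (σ * t) (hmaps ht)
  rw [projectedField_eq hH hWL] at h1
  have h2 : HasDerivWithinAt (fun t => σ * t) σ (Icc 0 T') t := by
    simpa using ((hasDerivAt_id t).const_mul σ).hasDerivWithinAt
  exact HasDerivWithinAt.scomp t h1 h2 hmaps

/-- Integral curves of `D^φ_x` that start near `a₀` stay near `a₀` for a uniform time. -/
theorem exists_mem_of_isProjectedCurve (hH : IsHomogeneousGroup X deg)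
    (hWL : IsHorizontalSplitting X deg k W L) {φ : W → L} {a₀ : W} (hφ : ContinuousAt φ a₀)
    (x : G) {O : Set W} (hO : O ∈ 𝓝 a₀) :
    ∃ O' ∈ 𝓝 a₀, ∃ τ > 0, ∀ a ∈ O', ∀ T γ, IsProjectedCurve hWL.isComplement φ x T a γ →
      ∀ t, |t| ≤ T → |t| ≤ τ → γ t ∈ O := by
  have hF : ContinuousAt (fun w : W => ‖projField X k x ((w : G) * (φ w : G))‖) a₀ := by
    refine ((continuous_projField x).continuousAt.comp ?_).norm
    refine ContinuousAt.comp (f := fun w : W => ((w : G), (φ w : G)))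
      (g := fun p : G × G => p.1 * p.2) (contDiff_mul (G := G)).continuous.continuousAt ?_
    exact continuous_subtype_val.continuousAt.prodMk
      (continuous_subtype_val.continuousAt.comp hφ)
  set M := ‖projField X k x ((a₀ : G) * (φ a₀ : G))‖ + 1 with hMdef
  have hM : 0 < M := by positivity
  have hev : ∀ᶠ w : W in 𝓝 a₀, ‖projField X k x ((w : G) * (φ w : G))‖ < M ∧ w ∈ O :=
    (hF.eventually_lt continuousAt_const (by simp [hMdef])).and hO
  obtain ⟨ε, hε, hball⟩ := Metric.eventually_nhds_iff.1 hev
  refine ⟨Metric.ball a₀ (ε / 2), Metric.ball_mem_nhds _ (by positivity), ε / (4 * M),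
    by positivity, ?_⟩
  intro a ha T γ hγ t htT htτ
  obtain ⟨σ, hσ, hσt⟩ : ∃ σ : ℝ, |σ| ≤ 1 ∧ σ * |t| = t := by
    rcases le_total 0 t with h | h
    · exact ⟨1, by simp, by rw [abs_of_nonneg h, one_mul]⟩
    · exact ⟨-1, by simp, by rw [abs_of_nonpos h]; ring⟩
  have hstart : (γ (σ * 0) : G) = (a : G) := by rw [mul_zero, hγ.2.2]
  have hdist : ∀ s, ‖(γ (σ * s) : G) - (γ (σ * 0) : G)‖ ≤ M * |t| → dist (γ (σ * s)) a₀ < ε := by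
    intro s hs
    rw [hstart, ← dist_eq_norm] at hs
    have h1 : M * |t| ≤ ε / 4 := by
      calc M * |t| ≤ M * (ε / (4 * M)) := by gcongr
        _ = ε / 4 := by field_simp
    have h2 : dist (γ (σ * s)) a ≤ M * |t| := hs
    have h3 := dist_triangle (γ (σ * s)) a a₀
    have h4 : dist a a₀ < ε / 2 := ha
    linarith
  have hmain := norm_sub_le_of_speed_lt (f := fun s => (γ (σ * s) : G)) (T := |t|) (M := M)
    (fun s hs => hγ.hasDerivWithinAt_mul hH hWL htT hσ hs) hM.le
    (fun s hs hle => by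
      have h1 := (hball (hdist s hle)).1
      rw [norm_smul, Real.norm_eq_abs]
      calc |σ| * _ ≤ 1 * _ := by gcongr
        _ < M := by rw [one_mul]; exact h1) |t| (right_mem_Icc.2 (abs_nonneg t))
  have := (hball (hdist |t| hmain)).2
  rwa [hσt] at this

end Curves

/-! ### Expansion of the function along a single flow -/

section Coordinates

variable {G : Type*} [NormedAddCommGroup G] [NormedSpace ℝ G] [FiniteDimensional ℝ G]
  [Group G] [LieGroup 𝓘(ℝ, G) ((⊤ : ℕ∞) : WithTop ℕ∞) G]
  {n : ℕ} {X : Module.Basis (Fin n) ℝ G} {deg : Fin n → ℕ} {k : ℕ} {W L : Subgroup G}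

theorem norm_le_of_forall_abs_le {ι : Type*} [Fintype ι] {v : EuclideanSpace ℝ ι} {c : ℝ}
    (hc : 0 ≤ c) (h : ∀ i, |v i| ≤ c) : ‖v‖ ≤ (Fintype.card ι + 1) * c := by
  rw [EuclideanSpace.norm_eq]
  refine Real.sqrt_le_iff.2 ⟨by positivity, ?_⟩
  calc ∑ i, ‖v i‖ ^ 2 ≤ ∑ _i : ι, c ^ 2 :=
        Finset.sum_le_sum fun i _ => pow_le_pow_left₀ (norm_nonneg _) (h i) 2
    _ = Fintype.card ι * c ^ 2 := by simp
    _ ≤ _ := by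
      have : (0 : ℝ) ≤ Fintype.card ι := by positivity
      nlinarith [mul_nonneg this (sq_nonneg c), mul_nonneg (mul_nonneg this this) (sq_nonneg c),
        sq_nonneg c]

theorem coordL_inv_mul (hH : IsHomogeneousGroup X deg) (hWL : IsHorizontalSplitting X deg k W L)
    (x y : L) : coordL X k (x⁻¹ * y) = coordL X k y - coordL X k x := by
  ext i
  simp only [coordL, PiLp.sub_apply]
  have h1 := hH.repr_mul (hWL.horizontal i i.2) ((x⁻¹ : L) : G) (y : G)
  rw [Subgroup.coe_mul, h1, Subgroup.coe_inv, inv_eq_neg_of_exp hH.exp_add, map_neg,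
    Finsupp.neg_apply]
  ring

theorem exists_dist_le_coordL (hH : IsHomogeneousGroup X deg)
    (hWL : IsHorizontalSplitting X deg k W L) {d : G → G → ℝ}
    (hd : IsHomogeneousDistance X deg d) :
    ∃ C > 0, ∀ l : L, d 1 (l : G) ≤ C * ‖coordL X k l‖ := by
  obtain ⟨C, hC, h⟩ := exists_dist_le_homGauge hd hH
  refine ⟨C * (n + 1), by positivity, fun l => (h l).trans ?_⟩
  rw [mul_assoc]
  gcongr
  have hi : ∀ i : Fin n, |X.repr (l : G) i| ^ (1 / (deg i : ℝ)) ≤ ‖coordL X k l‖ := by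
    intro i
    by_cases hik : (i : ℕ) < k
    · rw [hWL.horizontal i hik, Nat.cast_one, div_one, Real.rpow_one]
      exact PiLp.norm_apply_le (coordL X k l) ⟨i, hik⟩
    · rw [hWL.mem_L_iff.1 l.2 i (by omega), abs_zero, Real.zero_rpow]
      · exact norm_nonneg _
      · have := hH.one_le_deg i
        positivity
  calc homGauge X deg (l : G) ≤ ∑ _i : Fin n, ‖coordL X k l‖ := Finset.sum_le_sum fun i _ => hi i
    _ = n * ‖coordL X k l‖ := by simp
    _ ≤ _ := by gcongr; linarith

/-- The `j`-th column of `A`, extended by zero to the indices `j` outside `HIndex deg k`. -/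
def gradColumn (A : Matrix (LIndex n k) (HIndex deg k) ℝ) (j : Fin n) :
    EuclideanSpace ℝ (LIndex n k) :=
  WithLp.toLp 2 fun l => if h : k ≤ (j : ℕ) ∧ deg j = 1 then A l ⟨j, h⟩ else 0

theorem gradColumn_eq_zero {A : Matrix (LIndex n k) (HIndex deg k) ℝ} {j : Fin n}
    (hj : ¬ (k ≤ (j : ℕ) ∧ deg j = 1)) : gradColumn A j = 0 := by
  ext l
  simp [gradColumn, hj]

variable (X) in
/-- The action of `A` on the coordinates of `g` of index less than `J`. -/
def partialGrad (A : Matrix (LIndex n k) (HIndex deg k) ℝ) (J : ℕ) (g : G) :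
    EuclideanSpace ℝ (LIndex n k) :=
  ∑ i ∈ Finset.univ.filter (fun i : Fin n => (i : ℕ) < J), X.repr g i • gradColumn A i

theorem partialGrad_succ (A : Matrix (LIndex n k) (HIndex deg k) ℝ) (j : Fin n) (g : G) :
    partialGrad X A (j + 1) g = partialGrad X A j g + X.repr g j • gradColumn A j := by
  have h : Finset.univ.filter (fun i : Fin n => (i : ℕ) < (j : ℕ) + 1)
      = insert j (Finset.univ.filter fun i : Fin n => (i : ℕ) < (j : ℕ)) := by
    ext i
    simp only [Finset.mem_filter, Finset.mem_univ, true_and, Finset.mem_insert, Fin.ext_iff]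
    omega
  unfold partialGrad
  rw [h, Finset.sum_insert (by simp), add_comm]

theorem partialGrad_start (A : Matrix (LIndex n k) (HIndex deg k) ℝ) (g : G) :
    partialGrad X A k g = 0 := by
  refine Finset.sum_eq_zero fun i hi => ?_
  rw [gradColumn_eq_zero, smul_zero]
  have := (Finset.mem_filter.1 hi).2
  omega

theorem exists_norm_partialGrad_le (hH : IsHomogeneousGroup X deg) {d : G → G → ℝ}
    (hd : IsHomogeneousDistance X deg d) (A : Matrix (LIndex n k) (HIndex deg k) ℝ) :
    ∃ C > 0, ∀ J g, ‖partialGrad X A J g‖ ≤ C * d 1 g := by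
  obtain ⟨C, hC, h⟩ := exists_abs_repr_le hd hH
  refine ⟨∑ i, C * ‖gradColumn A i‖ + 1, by positivity, fun J g => ?_⟩
  have h0 := hd.nonneg 1 g
  have hi : ∀ i, ‖X.repr g i • gradColumn A i‖ ≤ C * ‖gradColumn A i‖ * d 1 g := by
    intro i
    by_cases hi : k ≤ (i : ℕ) ∧ deg i = 1
    · have h1 := h g i
      rw [hi.2, pow_one] at h1
      rw [norm_smul, Real.norm_eq_abs]
      calc |X.repr g i| * ‖gradColumn A i‖ ≤ C * d 1 g * ‖gradColumn A i‖ := by gcongr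
        _ = _ := by ring
    · rw [gradColumn_eq_zero hi]; simp
  calc ‖partialGrad X A J g‖
      ≤ ∑ i ∈ Finset.univ.filter (fun i : Fin n => (i : ℕ) < J), C * ‖gradColumn A i‖ * d 1 g :=
        (norm_sum_le _ _).trans (Finset.sum_le_sum fun i _ => hi i)
    _ ≤ ∑ i : Fin n, C * ‖gradColumn A i‖ * d 1 g :=
        Finset.sum_le_univ_sum_of_nonneg fun i => by positivity
    _ = (∑ i, C * ‖gradColumn A i‖) * d 1 g := by rw [Finset.sum_mul]
    _ ≤ _ := by gcongr; linarith

end Coordinates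

section Flows

variable {G : Type*} [NormedAddCommGroup G] [NormedSpace ℝ G] [FiniteDimensional ℝ G]
  [Group G] [LieGroup 𝓘(ℝ, G) ((⊤ : ℕ∞) : WithTop ℕ∞) G]
  {n : ℕ} {X : Module.Basis (Fin n) ℝ G} {deg : Fin n → ℕ} {k : ℕ} {W L : Subgroup G}

/-- Near `a₀` there are integral curves of `D^φ_j` along which `φ` has the expansion of first
order, in the homogeneous sense, given by the column `j` of `A`. -/
def HasExpansionAt (X : Module.Basis (Fin n) ℝ G) (deg : Fin n → ℕ)
    (h : Subgroup.IsComplement' W L) (U : Set W) (φ : W → L)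
    (A : Matrix (LIndex n k) (HIndex deg k) ℝ) (a₀ : W) (j : Fin n) : Prop :=
  ∃ E : W → ℝ → W, ∀ ε > 0, ∃ O ∈ 𝓝 a₀, ∃ δ > 0, ∀ c ∈ O,
    IsProjectedCurve h φ (X j) δ c (E c) ∧ ∀ t, |t| ≤ δ → E c t ∈ U ∧
      ‖coordL X k (φ (E c t)) - coordL X k (φ c) - t • gradColumn A j‖
        ≤ ε * |t| ^ (1 / (deg j : ℝ))

theorem IsVerticallyBroadStarHolder.hasExpansionAt {U : Set W} {φ : W → L}
    {h : Subgroup.IsComplement' W L} (hv : IsVerticallyBroadStarHolder X deg k h U φ)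
    {A : Matrix (LIndex n k) (HIndex deg k) ℝ} {a₀ : W} (ha₀ : a₀ ∈ U) {j : Fin n}
    (hj : 1 < deg j) : HasExpansionAt X deg h U φ A a₀ j := by
  obtain ⟨δ, hδ, U₁, hU₁, U₂, hU₂, -, -, -, hU₂U, E, hE, hεE⟩ := hv a₀ ha₀
  refine ⟨E ⟨j, hj⟩, fun ε hε => ?_⟩
  obtain ⟨ρ, hρ, hlim⟩ := hεE ε hε
  refine ⟨U₁, hU₁, min δ ρ, lt_min hδ hρ, fun c hc => ?_⟩
  obtain ⟨hmem, hcurve⟩ := hE ⟨j, hj⟩ c hc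
  refine ⟨hcurve.mono (min_le_left _ _), fun t ht => ?_⟩
  have htδ : t ∈ Icc (-δ) δ := abs_le.1 (ht.trans (min_le_left _ _))
  refine ⟨hU₂U (subset_closure (hmem t htδ)), ?_⟩
  rw [gradColumn_eq_zero (by omega), smul_zero, sub_zero]
  have h0 : E ⟨j, hj⟩ c 0 = c := hcurve.2.2
  rcases eq_or_ne t 0 with rfl | ht0
  · rw [h0, sub_self, norm_zero]
    positivity
  · have h1 := hlim ⟨j, hj⟩ c hc t htδ 0 ⟨by linarith, hδ.le⟩ (by simpa using ht0)
      (by simpa using ht.trans (min_le_right _ _))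
    rw [h0, sub_zero] at h1
    exact (div_le_iff₀ (Real.rpow_pos_of_pos (abs_pos.2 ht0) _)).1 h1

theorem IsBroadStar.hasExpansionAt (hH : IsHomogeneousGroup X deg)
    (hWL : IsHorizontalSplitting X deg k W L) {d : G → G → ℝ}
    (hd : IsHomogeneousDistance X deg d) {U : Set W} (hU : IsOpen U) {φ : W → L}
    (hφ : ContinuousOn φ U) {ω : W → Matrix (LIndex n k) (HIndex deg k) ℝ} (hω : ContinuousOn ω U)
    (hb : IsBroadStar X deg d k hWL.isComplement U φ ω) {a₀ : W} (ha₀ : a₀ ∈ U) {j : Fin n}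
    (hkj : k ≤ (j : ℕ)) (hj : deg j = 1) :
    HasExpansionAt X deg hWL.isComplement U φ (ω a₀) a₀ j := by
  obtain ⟨δ₁, δ₂, hδ₂, hδ₁₂, E, hE⟩ := hb a₀ ha₀
  have hU₀ : U ∈ 𝓝 a₀ := hU.mem_nhds ha₀
  refine ⟨E ⟨j, hkj, hj⟩, fun ε hε => ?_⟩
  set ε' := ε / (Fintype.card (LIndex n k) + 1) with hε'
  have hε'0 : 0 < ε' := by positivity
  have hωi : ∀ i : LIndex n k, ContinuousOn (fun w => ω w i ⟨j, hkj, hj⟩) U := fun i =>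
    continuousOn_pi.1 (continuousOn_pi.1 hω i) ⟨j, hkj, hj⟩
  have hO₁ : U ∩ {w | ∀ i : LIndex n k, |ω w i ⟨j, hkj, hj⟩ - ω a₀ i ⟨j, hkj, hj⟩| < ε'} ∈
      𝓝 a₀ := by
    refine inter_mem hU₀ ?_
    rw [← Filter.eventually_iff, Filter.eventually_all]
    intro i
    have h1 : ContinuousAt (fun w => |ω w i ⟨j, hkj, hj⟩ - ω a₀ i ⟨j, hkj, hj⟩|) a₀ :=
      (((hωi i).continuousAt hU₀).sub continuousAt_const).abs
    exact h1.eventually_lt continuousAt_const (by simpa using hε'0)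
  obtain ⟨O', hO', τ, hτ, htrap⟩ :=
    exists_mem_of_isProjectedCurve hH hWL (hφ.continuousAt hU₀) (X j) hO₁
  have hball : {w : W | d a₀ w ≤ δ₂} ∈ 𝓝 a₀ := by
    have h1 : ContinuousAt (fun w : W => d a₀ w) a₀ :=
      (hd.continuous.comp (continuous_const.prodMk continuous_subtype_val)).continuousAt
    have h2 : ∀ᶠ w : W in 𝓝 a₀, d a₀ w < δ₂ :=
      h1.eventually_lt continuousAt_const (by rw [(hd.eq_zero_iff _ _).2 rfl]; exact hδ₂)
    exact h2.mono fun w hw => hw.le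
  refine ⟨O' ∩ (U ∩ {w : W | d a₀ w ≤ δ₂}), inter_mem hO' (inter_mem hU₀ hball), min τ δ₂,
    lt_min hτ hδ₂, ?_⟩
  rintro c ⟨hcO, hcU, hcδ⟩
  obtain ⟨hmem, hcurve, hint⟩ := hE ⟨j, hkj, hj⟩ c hcU hcδ
  refine ⟨hcurve.mono (min_le_right _ _), fun t ht => ?_⟩
  have htδ : t ∈ Icc (-δ₂) δ₂ := abs_le.1 (ht.trans (min_le_right _ _))
  refine ⟨(hmem t htδ).1, ?_⟩
  have hpow : |t| ^ (1 / (deg j : ℝ)) = |t| := by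
    rw [hj, Nat.cast_one, div_one, Real.rpow_one]
  rw [hpow]
  have hcomp : ∀ i : LIndex n k, |(coordL X k (φ (E ⟨j, hkj, hj⟩ c t)) - coordL X k (φ c)
      - t • gradColumn (ω a₀) j) i| ≤ ε' * |t| := by
    intro i
    have h1 := hint t htδ i
    have hsub : uIcc 0 t ⊆ Icc (-δ₂) δ₂ := by
      rw [← uIcc_of_le (by linarith : -δ₂ ≤ δ₂)]
      refine uIcc_subset_uIcc ?_ ?_ <;> rw [uIcc_of_le (by linarith)]
      · exact ⟨by linarith, hδ₂.le⟩
      · exact htδ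
    have hcont : ContinuousOn (fun r => ω (E ⟨j, hkj, hj⟩ c r) i ⟨j, hkj, hj⟩) (uIcc 0 t) :=
      (hωi i).comp (hcurve.continuousOn.mono hsub) fun r hr => (hmem r (hsub hr)).1
    have h2 : (coordL X k (φ (E ⟨j, hkj, hj⟩ c t)) - coordL X k (φ c)
        - t • gradColumn (ω a₀) j) i = ∫ r in (0 : ℝ)..t,
          (ω (E ⟨j, hkj, hj⟩ c r) i ⟨j, hkj, hj⟩ - ω a₀ i ⟨j, hkj, hj⟩) := by
      rw [intervalIntegral.integral_sub hcont.intervalIntegrable intervalIntegrable_const, ← h1]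
      simp [gradColumn, hkj, hj]
    rw [h2, ← Real.norm_eq_abs]
    refine (intervalIntegral.norm_integral_le_of_norm_le_const (C := ε') fun r hr => ?_).trans
      (by rw [sub_zero])
    have hr' : |r| ≤ |t| := by
      have := Set.uIoc_subset_uIcc hr
      simpa using Set.abs_sub_left_of_mem_uIcc this
    have h3 := htrap c hcO _ _ hcurve r (hr'.trans (abs_le.2 htδ))
      (hr'.trans (ht.trans (min_le_left _ _)))
    exact (h3.2 i).le
  refine (norm_le_of_forall_abs_le (by positivity) hcomp).trans (le_of_eq ?_)
  rw [hε']
  field_simp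

end Flows

/-! ### Concatenation of flows -/

section Paths

variable {G : Type*} [NormedAddCommGroup G] [NormedSpace ℝ G] [FiniteDimensional ℝ G]
  [Group G] [LieGroup 𝓘(ℝ, G) ((⊤ : ℕ∞) : WithTop ℕ∞) G]
  {n : ℕ} {X : Module.Basis (Fin n) ℝ G} {deg : Fin n → ℕ} {k : ℕ} {W L : Subgroup G}

variable (X k) in
/-- The point `c` seen from the point of the graph of `φ` over `a`: the left translation which
maps `a * φ a` to `1` sends the fibre of `π_W` over `c` to that over `relPoint X k φ a c`. -/
def relPoint (φ : W → L) (a : W) (c : G) : G := wTranslate X k ((a : G) * (φ a : G))⁻¹ c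

section
variable (hH : IsHomogeneousGroup X deg) (hWL : IsHorizontalSplitting X deg k W L)
include hH hWL

theorem horizontalPart_inv_graph (φ : W → L) (a : W) :
    horizontalPart X k ((a : G) * (φ a : G))⁻¹ = (φ a : G)⁻¹ := by
  rw [mul_inv_rev, horizontalPart_mul hH hWL,
    (horizontalPart_eq_one_iff hH hWL).2 (W.inv_mem a.2), mul_one,
    hWL.horizontalPart_of_mem_L (L.inv_mem (φ a).2)]

theorem relPoint_eq (φ : W → L) (a : W) (c : G) :
    relPoint X k φ a c = (φ a : G)⁻¹ * (a : G)⁻¹ * c * (φ a : G) := by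
  unfold relPoint wTranslate
  rw [horizontalPart_inv_graph hH hWL]
  group

theorem relPoint_self (φ : W → L) (a : W) : relPoint X k φ a a = 1 := by
  rw [relPoint_eq hH hWL]
  group

/-- If `a` is close to `a₀` and `c` is close to `a` as seen from the graph, then `c` is close to
`a₀`. -/
theorem exists_mem_of_dist_relPoint_lt {d : G → G → ℝ} (hd : IsHomogeneousDistance X deg d)
    {φ : W → L} {a₀ : W} (hφ : ContinuousAt φ a₀) {O : Set W} (hO : O ∈ 𝓝 a₀) :
    ∃ r > 0, ∀ a : W, d a₀ a < r → ∀ c : W, d 1 (relPoint X k φ a c) < r → c ∈ O := by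
  have : IsTopologicalGroup G := topologicalGroup_of_lieGroup 𝓘(ℝ, G) ((⊤ : ℕ∞) : WithTop ℕ∞)
  have hφ' : ContinuousAt (fun p : W × G => (φ p.1 : G)) (a₀, 1) :=
    continuous_subtype_val.continuousAt.comp
      (ContinuousAt.comp (f := Prod.fst) (g := φ) (x := ((a₀, 1) : W × G)) hφ continuousAt_fst)
  have hΨ : ContinuousAt (fun p : W × G => (p.1 : G) * (φ p.1 : G) * p.2 * (φ p.1 : G)⁻¹)
      (a₀, 1) :=
    (((continuous_subtype_val.comp continuous_fst).continuousAt.mul hφ').mul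
      continuousAt_snd).mul hφ'.inv
  rw [nhds_subtype_eq_comap, mem_comap] at hO
  obtain ⟨O', hO', hOO'⟩ := hO
  have h0 : (a₀ : G) * (φ a₀ : G) * 1 * (φ a₀ : G)⁻¹ = a₀ := by group
  have h1 := hΨ (by simpa only [h0] using hO')
  rw [mem_map, mem_nhds_prod_iff] at h1
  obtain ⟨u, hu, v, hv, huv⟩ := h1
  rw [nhds_subtype_eq_comap, mem_comap] at hu
  obtain ⟨u', hu', huu'⟩ := hu
  obtain ⟨r₁, hr₁, h₁⟩ := exists_ball_subset hd hH hu'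
  obtain ⟨r₂, hr₂, h₂⟩ := exists_ball_subset hd hH hv
  refine ⟨min r₁ r₂, lt_min hr₁ hr₂, fun a ha c hc => hOO' ?_⟩
  have h3 : (a, relPoint X k φ a c) ∈ u ×ˢ v :=
    ⟨huu' (h₁ a (ha.trans_le (min_le_left _ _))), h₂ _ (hc.trans_le (min_le_right _ _))⟩
  have h4 := huv h3
  rw [mem_preimage] at h4 ⊢
  have h5 : (a : G) * (φ a : G) * relPoint X k φ a c * (φ a : G)⁻¹ = c := by
    rw [relPoint_eq hH hWL]; group
  rwa [h5] at h4

end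

/-- For `a` near `a₀` and small `b ∈ W` there is a point `c` which, seen from the graph over `a`,
agrees with `b` in the coordinates of index less than `J` and has no other coordinates of degree
one, and such that `φ c - φ a` is, up to a small error, given by the first `J` coordinates
of `b`. -/
def HasPartialExpansion (X : Module.Basis (Fin n) ℝ G) (deg : Fin n → ℕ) (d : G → G → ℝ)
    (U : Set W) (φ : W → L) (A : Matrix (LIndex n k) (HIndex deg k) ℝ) (a₀ : W) (J : ℕ) : Prop :=
  ∃ K > 0, ∀ ε > 0, ∃ r > 0, ∀ a ∈ U, d a₀ a < r → ∀ b : W, b ≠ 1 → d 1 b < r →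
    ∃ c ∈ U, (∀ i : Fin n, (i : ℕ) < J → X.repr (relPoint X k φ a c) i = X.repr (b : G) i) ∧
      (∀ i : Fin n, deg i = 1 → J ≤ (i : ℕ) → X.repr (relPoint X k φ a c) i = 0) ∧
      d 1 (relPoint X k φ a c) ≤ K * d 1 b ∧
      ‖coordL X k (φ c) - coordL X k (φ a) - partialGrad X A J (b : G)‖ ≤ ε * d 1 b

theorem hasPartialExpansion_start (hH : IsHomogeneousGroup X deg)
    (hWL : IsHorizontalSplitting X deg k W L) {d : G → G → ℝ}
    (hd : IsHomogeneousDistance X deg d) (U : Set W) (φ : W → L)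
    (A : Matrix (LIndex n k) (HIndex deg k) ℝ) (a₀ : W) :
    HasPartialExpansion X deg d U φ A a₀ k := by
  have h0 : ∀ i, X.repr (1 : G) i = 0 := fun i => by rw [hH.one_eq_zero]; simp
  refine ⟨1, one_pos, fun ε hε => ⟨1, one_pos, fun a ha _ b _ _ => ⟨a, ha, ?_⟩⟩⟩
  rw [relPoint_self hH hWL, partialGrad_start, (hd.eq_zero_iff 1 1).2 rfl]
  have hb := hd.nonneg 1 (b : G)
  refine ⟨fun i hi => ?_, fun i _ _ => h0 i, by positivity, ?_⟩
  · rw [h0, hWL.mem_W_iff.1 b.2 i hi]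
  · rw [sub_self, sub_zero, norm_zero]
    positivity

theorem abs_mul_norm_gradColumn_le {j : Fin n}
    (A : Matrix (LIndex n k) (HIndex deg k) ℝ) (s : ℝ) :
    |s| * ‖gradColumn A j‖ ≤ ‖gradColumn A j‖ * |s| ^ (1 / (deg j : ℝ)) := by
  by_cases h : deg j = 1
  · have hpow : |s| ^ (1 / (deg j : ℝ)) = |s| := by
      rw [h, Nat.cast_one, div_one, Real.rpow_one]
    rw [hpow, mul_comm]
  · rw [gradColumn_eq_zero (fun h' => h h'.2)]
    simp

/-- Flowing along the `j`-th field corrects the `j`-th coordinate and leaves the previous ones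
unchanged. -/
theorem HasPartialExpansion.succ (hH : IsHomogeneousGroup X deg)
    (hWL : IsHorizontalSplitting X deg k W L) {d : G → G → ℝ}
    (hd : IsHomogeneousDistance X deg d) {U : Set W} {φ : W → L} {a₀ : W}
    (hφ : ContinuousAt φ a₀) {A : Matrix (LIndex n k) (HIndex deg k) ℝ} {j : Fin n}
    (hkj : k ≤ (j : ℕ)) (hj : HasExpansionAt X deg hWL.isComplement U φ A a₀ j)
    (h : HasPartialExpansion X deg d U φ A a₀ j) :
    HasPartialExpansion X deg d U φ A a₀ (j + 1) := by
  obtain ⟨K, hK, hIH⟩ := h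
  obtain ⟨E, hE⟩ := hj
  obtain ⟨C₁, hC₁, hrepr⟩ := exists_abs_repr_le hd hH
  obtain ⟨C₂, hC₂, hcoord⟩ := exists_dist_le_coordL hH hWL hd
  obtain ⟨C₃, hC₃, hgrad⟩ := exists_norm_partialGrad_le hH hd A
  obtain ⟨τ, hτ, C₄, hC₄, hdrift⟩ := exists_dist_le_of_curve hH hWL hd j
  have hp : 1 ≤ deg j := hH.one_le_deg j
  set p := deg j with hpdef
  set v := gradColumn A j with hv
  -- The time of the flow is at most `C₅ * R ^ p`, where `R = d 1 b`.
  set C₅ := C₁ * (1 + K ^ p) with hC₅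
  have hC₅0 : 0 < C₅ := by positivity
  set C₆ := C₅ ^ (1 / (p : ℝ)) with hC₆
  have hC₆0 : 0 < C₆ := Real.rpow_pos_of_pos hC₅0 _
  -- `K₂ * R` bounds the variation of `φ` along the flow; at the scale `K₃ * R` the time of the flow
  -- is also short enough for `exists_dist_le_of_curve`.
  set K₂ := C₂ * (1 + C₃ + (1 + ‖v‖) * C₆) with hK₂
  have hK₂0 : 0 < K₂ := by positivity
  set K₃ := K₂ + C₅ / τ + 1 with hK₃
  have hK₃1 : 1 ≤ K₃ := by
    have : 0 < C₅ / τ := by positivity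
    linarith
  refine ⟨K + C₄ * K₃, by positivity, fun ε hε => ?_⟩
  obtain ⟨r₀, hr₀, hIHr⟩ := hIH (min 1 (ε / 2)) (by positivity)
  obtain ⟨O, hO, δ, hδ, hflow⟩ := hE (min 1 (ε / (2 * C₆))) (by positivity)
  obtain ⟨r₁, hr₁, hnear⟩ := exists_mem_of_dist_relPoint_lt hH hWL hd hφ hO
  refine ⟨min (min r₀ 1) (min r₁ (min (r₁ / K) (δ / C₅))), by positivity, ?_⟩
  intro a ha had b hb1 hbr
  have hbG : (b : G) ≠ 1 := fun h => hb1 (Subtype.ext h)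
  set R := d 1 (b : G) with hR
  have hR0 : 0 < R := hd.one_pos hbG
  obtain ⟨⟨hRr₀, hR1⟩, hRr₁, hRK, hRδ⟩ : (R < r₀ ∧ R < 1) ∧ R < r₁ ∧ R < r₁ / K ∧ R < δ / C₅ := by
    simpa only [lt_min_iff] using hbr
  obtain ⟨⟨har₀, -⟩, har₁, -, -⟩ : (d a₀ a < r₀ ∧ d a₀ a < 1) ∧ d a₀ a < r₁ ∧ d a₀ a < r₁ / K ∧
      d a₀ a < δ / C₅ := by
    simpa only [lt_min_iff] using had
  obtain ⟨c, hcU, hclt, hcdeg, hcd, hcφ⟩ := hIHr a ha har₀ b hb1 hRr₀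
  have hcO : c ∈ O := hnear a har₁ c <| hcd.trans_lt <| by
    rw [mul_comm]; exact (lt_div_iff₀ hK).1 hRK
  obtain ⟨hcurve, hEc⟩ := hflow c hcO
  set t := X.repr (b : G) j - X.repr (relPoint X k φ a c) j with ht
  have htR : |t| ≤ C₅ * R ^ p := by
    calc |t| ≤ |X.repr (b : G) j| + |X.repr (relPoint X k φ a c) j| := abs_sub _ _
      _ ≤ C₁ * R ^ p + C₁ * (K * R) ^ p := by
        refine add_le_add (hrepr _ _) ((hrepr _ _).trans ?_)
        have := hd.nonneg 1 (relPoint X k φ a c)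
        gcongr
      _ = C₅ * R ^ p := by rw [hC₅, mul_pow]; ring
  have htδ : |t| ≤ δ := by
    have h1 : R ^ p ≤ R := pow_le_of_le_one hR0.le hR1.le (by omega)
    calc |t| ≤ C₅ * R := htR.trans (by gcongr)
      _ ≤ δ := by rw [mul_comm]; exact ((lt_div_iff₀ hC₅0).1 hRδ).le
  have hroot : ∀ s, |s| ≤ |t| → |s| ^ (1 / (p : ℝ)) ≤ C₆ * R := by
    intro s hs
    calc |s| ^ (1 / (p : ℝ)) ≤ (C₅ * R ^ p) ^ (1 / (p : ℝ)) :=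
          Real.rpow_le_rpow (abs_nonneg s) (hs.trans htR) (by positivity)
      _ = C₆ * R := by
        rw [Real.mul_rpow hC₅0.le (by positivity), pow_rpow_one_div hR0.le hp]
  have hφa : ‖coordL X k (φ c) - coordL X k (φ a)‖ ≤ (1 + C₃) * R := by
    calc ‖coordL X k (φ c) - coordL X k (φ a)‖
        ≤ ‖coordL X k (φ c) - coordL X k (φ a) - partialGrad X A j (b : G)‖
          + ‖partialGrad X A j (b : G)‖ := by
          simpa using norm_add_le (coordL X k (φ c) - coordL X k (φ a)
            - partialGrad X A j (b : G)) (partialGrad X A j (b : G))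
      _ ≤ 1 * R + C₃ * R := by
        refine add_le_add (hcφ.trans ?_) (hgrad _ _)
        gcongr
        exact min_le_left _ _
      _ = _ := by ring
  have hφE : ∀ s, |s| ≤ |t| →
      ‖coordL X k (φ (E c s)) - coordL X k (φ a)‖ ≤ (1 + C₃ + (1 + ‖v‖) * C₆) * R := by
    intro s hs
    have h1 := (hEc s (hs.trans htδ)).2
    have h2 : ‖s • v‖ ≤ ‖v‖ * |s| ^ (1 / (p : ℝ)) := by
      rw [norm_smul, Real.norm_eq_abs]
      exact abs_mul_norm_gradColumn_le A s
    have h3 := hroot s hs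
    have h4 : min 1 (ε / (2 * C₆)) * |s| ^ (1 / (p : ℝ)) ≤ 1 * |s| ^ (1 / (p : ℝ)) := by
      gcongr
      exact min_le_left _ _
    have h5 : coordL X k (φ (E c s)) - coordL X k (φ a)
        = (coordL X k (φ (E c s)) - coordL X k (φ c) - s • v) + s • v
          + (coordL X k (φ c) - coordL X k (φ a)) := by abel
    have h6 : (1 + ‖v‖) * |s| ^ (1 / (p : ℝ)) ≤ (1 + ‖v‖) * (C₆ * R) := by gcongr
    rw [h5]
    refine (norm_add₃_le).trans ?_
    linarith
  obtain ⟨σ, hσ, hσt⟩ : ∃ σ : ℝ, |σ| ≤ 1 ∧ σ * |t| = t := by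
    rcases le_total 0 t with h | h
    · exact ⟨1, by simp, by rw [abs_of_nonneg h, one_mul]⟩
    · exact ⟨-1, by simp, by rw [abs_of_nonpos h]; ring⟩
  have hσs : ∀ s ∈ Icc 0 |t|, |σ * s| ≤ |t| := by
    intro s hs
    rw [abs_mul, abs_of_nonneg hs.1]
    calc |σ| * s ≤ 1 * s := by gcongr; exact hs.1
      _ ≤ |t| := by linarith [hs.2]
  set γ : ℝ → G := fun s => relPoint X k φ a (E c (σ * s)) with hγ
  set η : ℝ → G := fun s => (((φ a)⁻¹ * φ (E c (σ * s)) : L) : G) with hη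
  have hder : ∀ s ∈ Icc 0 |t|,
      HasDerivWithinAt γ (σ • projField X k (X j) (γ s * η s)) (Icc 0 |t|) s := by
    intro s hs
    have h1 := hcurve.hasDerivWithinAt_mul hH hWL htδ hσ hs
    have h2 := hasDerivWithinAt_wTranslate (γ := fun s => (E c (σ * s) : G))
      (η := fun s => (φ (E c (σ * s)) : G)) hH hWL ((a : G) * (φ a : G))⁻¹
      (E c (σ * s)).2 (φ (E c (σ * s))).2 h1
    have h3 : ((a : G) * (φ a : G))⁻¹ * ((E c (σ * s) : G) * (φ (E c (σ * s)) : G))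
        = γ s * η s := by
      simp only [hγ, hη, relPoint_eq hH hWL, Subgroup.coe_mul, Subgroup.coe_inv]
      group
    rw [h3] at h2
    exact h2
  have hγ0 : γ 0 = relPoint X k φ a c := by
    simp only [hγ, mul_zero, hcurve.2.2]
  have hγt : γ |t| = relPoint X k φ a (E c t) := by
    simp only [hγ, hσt]
  have htmem : |t| ∈ Icc 0 |t| := right_mem_Icc.2 (abs_nonneg t)
  have hcoords : ∀ i, deg i ≤ deg j → X.repr (relPoint X k φ a (E c t)) i
      = X.repr (relPoint X k φ a c) i + if i = j then t else 0 := by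
    intro i hi
    have h1 := repr_eq_of_curve hH hWL hkj hder hi htmem
    rwa [hγ0, hγt, hσt] at h1
  have hdist : d 1 (relPoint X k φ a (E c t)) ≤ K * R + C₄ * (K₃ * R) := by
    have hT : |t| ≤ τ * (K₃ * R) ^ deg j := by
      refine htR.trans ?_
      rw [← hpdef, mul_pow, ← mul_assoc]
      gcongr
      have h1 : C₅ / τ ≤ K₃ := by linarith
      have h2 : K₃ ≤ K₃ ^ p := le_self_pow₀ hK₃1 (by omega)
      rw [mul_comm]
      exact (div_le_iff₀ hτ).1 (h1.trans h2)
    have h1 := hdrift (K₃ * R) (by positivity) |t| (abs_nonneg t) hT σ hσ γ η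
      (fun s hs => ⟨wTranslate_mem hH hWL _ (E c (σ * s)).2, SetLike.coe_mem _, by
        refine (hcoord _).trans ?_
        rw [coordL_inv_mul hH hWL]
        calc C₂ * ‖coordL X k (φ (E c (σ * s))) - coordL X k (φ a)‖
            ≤ C₂ * ((1 + C₃ + (1 + ‖v‖) * C₆) * R) := by gcongr; exact hφE _ (hσs s hs)
          _ = K₂ * R := by rw [hK₂]; ring
          _ ≤ K₃ * R := by
            gcongr
            have : 0 < C₅ / τ := by positivity
            linarith, hder s hs⟩) |t| htmem
    rw [hγ0, hγt] at h1
    have h2 := hd.one_mul_le (relPoint X k φ a c)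
      ((relPoint X k φ a c)⁻¹ * relPoint X k φ a (E c t))
    rw [mul_inv_cancel_left] at h2
    linarith
  refine ⟨E c t, (hEc t htδ).1, fun i hi => ?_, fun i hi hji => ?_, by linarith, ?_⟩
  · rw [hcoords i (hH.deg_mono (Fin.le_def.2 (by omega)))]
    rcases (Nat.lt_succ_iff.1 hi).lt_or_eq with h | h
    · rw [if_neg (fun h' => by rw [h'] at h; omega), add_zero, hclt i h]
    · have hij : i = j := Fin.ext h
      rw [if_pos hij, hij, ht]
      ring
  · rw [hcoords i (by omega), if_neg (fun h' => by rw [h'] at hji; omega), add_zero,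
      hcdeg i hi (by omega)]
  · have hcol : t • v = X.repr (b : G) j • v := by
      by_cases h1 : deg j = 1
      · rw [ht, hcdeg j h1 le_rfl, sub_zero]
      · rw [hv, gradColumn_eq_zero (fun h' => h1 h'.2), smul_zero, smul_zero]
    have h1 : coordL X k (φ (E c t)) - coordL X k (φ a) - partialGrad X A (j + 1) (b : G)
        = (coordL X k (φ (E c t)) - coordL X k (φ c) - t • v)
          + (coordL X k (φ c) - coordL X k (φ a) - partialGrad X A j (b : G)) := by
      rw [partialGrad_succ, ← hv, ← hcol]
      abel
    rw [h1]
    refine (norm_add_le _ _).trans ?_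
    have h2 : min 1 (ε / (2 * C₆)) * |t| ^ (1 / (p : ℝ)) ≤ ε / (2 * C₆) * (C₆ * R) := by
      gcongr
      · exact min_le_right _ _
      · exact hroot t le_rfl
    have h3 : ε / (2 * C₆) * (C₆ * R) = ε / 2 * R := by field_simp
    have h4 : min 1 (ε / 2) * R ≤ ε / 2 * R := by
      gcongr
      exact min_le_right _ _
    have h5 := (hEc t htδ).2
    linarith

/-- Concatenating the flows of all fields, every small `b` is reached. -/
theorem hasPartialExpansion_of_hasExpansionAt (hH : IsHomogeneousGroup X deg)
    (hWL : IsHorizontalSplitting X deg k W L) {d : G → G → ℝ}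
    (hd : IsHomogeneousDistance X deg d) {U : Set W} {φ : W → L} {a₀ : W}
    (hφ : ContinuousAt φ a₀) {A : Matrix (LIndex n k) (HIndex deg k) ℝ}
    (hj : ∀ j : Fin n, k ≤ (j : ℕ) → HasExpansionAt X deg hWL.isComplement U φ A a₀ j) :
    HasPartialExpansion X deg d U φ A a₀ n := by
  have h : ∀ J, k ≤ J → J ≤ n → HasPartialExpansion X deg d U φ A a₀ J := by
    intro J hJ
    induction J, hJ using Nat.le_induction with
    | base => exact fun _ => hasPartialExpansion_start hH hWL hd U φ A a₀
    | succ J hJ ih =>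
      exact fun hJn => HasPartialExpansion.succ (j := ⟨J, hJn⟩) hH hWL hd hφ hJ (hj _ hJ)
        (ih (by omega))
  exact h n hWL.le le_rfl

/-- The expansion of `φ` at the points near `a₀`, seen from the points of its graph. -/
theorem exists_norm_sub_partialGrad_le (hH : IsHomogeneousGroup X deg)
    (hWL : IsHorizontalSplitting X deg k W L) {d : G → G → ℝ}
    (hd : IsHomogeneousDistance X deg d) {U : Set W} {φ : W → L} {a₀ : W}
    (hφ : ContinuousAt φ a₀) {A : Matrix (LIndex n k) (HIndex deg k) ℝ}
    (hj : ∀ j : Fin n, k ≤ (j : ℕ) → HasExpansionAt X deg hWL.isComplement U φ A a₀ j)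
    {ε : ℝ} (hε : 0 < ε) :
    ∃ r > 0, ∀ a ∈ U, d a₀ a < r → ∀ b : W, b ≠ 1 → d 1 b < r → ∀ c : W,
      relPoint X k φ a c = b →
        ‖coordL X k (φ c) - coordL X k (φ a) - partialGrad X A n (b : G)‖ ≤ ε * d 1 b := by
  obtain ⟨K, -, h⟩ := hasPartialExpansion_of_hasExpansionAt hH hWL hd hφ hj
  obtain ⟨r, hr, hr'⟩ := h ε hε
  refine ⟨r, hr, fun a ha had b hb hbr c hc => ?_⟩
  obtain ⟨c', -, hcoords, -, -, hle⟩ := hr' a ha had b hb hbr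
  have h1 : relPoint X k φ a c' = relPoint X k φ a c := by
    rw [hc]
    exact X.ext_elem fun i => hcoords i i.2
  have h2 : c' = c := by
    rw [relPoint_eq hH hWL, relPoint_eq hH hWL] at h1
    exact Subtype.ext (mul_left_cancel (mul_right_cancel h1))
  rwa [h2] at hle

end Paths

/-! ### The intrinsic differential -/

section Differential

variable {G : Type*} [NormedAddCommGroup G] [NormedSpace ℝ G] [FiniteDimensional ℝ G]
  [Group G] [LieGroup 𝓘(ℝ, G) ((⊤ : ℕ∞) : WithTop ℕ∞) G]
  {n : ℕ} {X : Module.Basis (Fin n) ℝ G} {deg : Fin n → ℕ} {k : ℕ} {W L : Subgroup G}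

/-- The intrinsically linear map with matrix `A`: it depends only on the coordinates of degree
one. -/
def gradMap (hWL : IsHorizontalSplitting X deg k W L)
    (A : Matrix (LIndex n k) (HIndex deg k) ℝ) (w : W) : L :=
  ⟨∑ i, A.mulVec (fun j => X.repr (w : G) (j : Fin n)) i • X (i : Fin n), by
    rw [← SetLike.mem_coe, hWL.L_eq]
    exact Submodule.sum_mem _ fun i _ => Submodule.smul_mem _ _
      (Submodule.subset_span ⟨i, i.2, rfl⟩)⟩

theorem repr_gradMap (hWL : IsHorizontalSplitting X deg k W L)
    (A : Matrix (LIndex n k) (HIndex deg k) ℝ) (w : W) (i : LIndex n k) :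
    X.repr (gradMap hWL A w : G) i = A.mulVec (fun j => X.repr (w : G) (j : Fin n)) i := by
  simp only [gradMap, map_sum, map_smul, Module.Basis.repr_self, Finsupp.coe_finsetSum,
    Finset.sum_apply, Finsupp.smul_apply, smul_eq_mul, Finsupp.single_apply]
  rw [Finset.sum_eq_single i]
  · simp
  · intro l _ hl
    rw [if_neg fun h => hl (Subtype.ext h), mul_zero]
  · simp

theorem coordL_gradMap (hWL : IsHorizontalSplitting X deg k W L)
    (A : Matrix (LIndex n k) (HIndex deg k) ℝ) (w : W) :
    coordL X k (gradMap hWL A w) = partialGrad X A n (w : G) := by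
  ext i
  simp only [coordL, repr_gradMap, partialGrad, Fin.is_lt, Finset.filter_true, WithLp.ofLp_sum,
    Finset.sum_apply, PiLp.smul_apply, smul_eq_mul, Matrix.mulVec, dotProduct]
  rw [← Finset.sum_filter_of_ne (p := fun j : Fin n => k ≤ (j : ℕ) ∧ deg j = 1),
    Finset.sum_subtype (p := fun j : Fin n => k ≤ (j : ℕ) ∧ deg j = 1)
      (Finset.univ.filter fun j : Fin n => k ≤ (j : ℕ) ∧ deg j = 1) (by simp)]
  · refine Finset.sum_congr rfl fun j _ => ?_
    simp [gradColumn, j.2.1, j.2.2, mul_comm]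
  · intro j _ hj
    by_contra h
    rw [gradColumn_eq_zero h] at hj
    simp at hj

section
variable (hH : IsHomogeneousGroup X deg) (hWL : IsHorizontalSplitting X deg k W L)
include hH hWL

theorem eq_of_repr_eq_of_mem_L {x y : L}
    (h : ∀ i : LIndex n k, X.repr (x : G) i = X.repr (y : G) i) : x = y := by
  refine Subtype.ext (X.ext_elem fun i => ?_)
  by_cases hi : (i : ℕ) < k
  · exact h ⟨i, hi⟩
  · rw [hWL.mem_L_iff.1 x.2 i (by omega), hWL.mem_L_iff.1 y.2 i (by omega)]

/-- The graph of `gradMap` is cut out by linear equations between coordinates of degree one, which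
are homomorphisms. -/
theorem isIntrinsicallyLinear_gradMap (A : Matrix (LIndex n k) (HIndex deg k) ℝ) :
    IsIntrinsicallyLinear X deg (gradMap hWL A) := by
  have hmulL : ∀ (x y : G) (i : LIndex n k), X.repr (x * y) i = X.repr x i + X.repr y i :=
    fun x y i => hH.repr_mul (hWL.horizontal i i.2) x y
  have hmulH : ∀ (x y : G), (fun j : HIndex deg k => X.repr (x * y) (j : Fin n))
      = (fun j : HIndex deg k => X.repr x (j : Fin n))
        + fun j : HIndex deg k => X.repr y (j : Fin n) :=
    fun x y => funext fun j => hH.repr_mul j.2.2 x y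
  have hzero : ∀ (l : G), l ∈ L → (fun j : HIndex deg k => X.repr l (j : Fin n)) = 0 :=
    fun l hl => funext fun j => hWL.mem_L_iff.1 hl j j.2.1
  let H : Subgroup G :=
    { carrier := {g | ∀ i : LIndex n k,
        X.repr g i = A.mulVec (fun j => X.repr g (j : Fin n)) i}
      mul_mem' := fun {x y} hx hy i => by
        rw [hmulL, hmulH, Matrix.mulVec_add, Pi.add_apply, hx, hy]
      one_mem' := fun i => by
        rw [hzero 1 L.one_mem, Matrix.mulVec_zero, hH.one_eq_zero]
        simp
      inv_mem' := fun {x} hx i => by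
        have e : (fun j : HIndex deg k => X.repr (-x) (j : Fin n))
            = -fun j : HIndex deg k => X.repr x (j : Fin n) := by
          funext j; simp
        rw [inv_eq_neg_of_exp hH.exp_add, e, Matrix.mulVec_neg, Pi.neg_apply, ← hx, map_neg,
          Finsupp.neg_apply] }
  refine ⟨H, ?_, fun r _ g hg i => ?_⟩
  · ext g
    constructor
    · intro hg
      have hw : wPart X k g ∈ W := by
        have := (projW hWL.isComplement g).2
        rwa [projW_eq hH hWL] at this
      have hg' : g = wPart X k g * horizontalPart X k g := by simp [wPart]
      refine ⟨⟨_, hw⟩, ?_⟩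
      have h1 : gradMap hWL A ⟨_, hw⟩ = ⟨_, hWL.horizontalPart_mem g⟩ := by
        refine eq_of_repr_eq_of_mem_L hH hWL fun i => ?_
        rw [repr_gradMap, repr_horizontalPart, if_pos i.2, hg i]
        conv_rhs => rw [hg']
        rw [hmulH, hzero _ (hWL.horizontalPart_mem g), add_zero]
      rw [h1]
      exact hg'
    · rintro ⟨w, rfl⟩ i
      rw [hmulL, hmulH, hzero _ (gradMap hWL A w).2, add_zero, repr_gradMap,
        hWL.mem_W_iff.1 w.2 i i.2, zero_add]
  · have e : (fun j : HIndex deg k => X.repr (dilation X deg r g) (j : Fin n))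
        = r • fun j : HIndex deg k => X.repr g (j : Fin n) := by
      funext j
      rw [repr_dilation, j.2.2, pow_one]
      rfl
    rw [e, Matrix.mulVec_smul, Pi.smul_apply, ← hg i, repr_dilation, hWL.horizontal i i.2, pow_one]
    rfl

/-- Intrinsically linear maps commute with dilations. -/
theorem IsIntrinsicallyLinear.map_dilation {ℓ : W → L} (hℓ : IsIntrinsicallyLinear X deg ℓ)
    {r : ℝ} (hr : 0 < r) (w : W) :
    (ℓ ⟨Carnot.dilation X deg r w, hWL.homogeneous_W r hr w w.2⟩ : G)
      = Carnot.dilation X deg r (ℓ w : G) := by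
  obtain ⟨H, hHgraph, hHdil⟩ := hℓ
  have h1 : (w : G) * (ℓ w : G) ∈ H := by
    rw [← SetLike.mem_coe, hHgraph]; exact ⟨w, rfl⟩
  have h2 := hHdil r hr _ h1
  rw [← SetLike.mem_coe, hHgraph] at h2
  obtain ⟨w', hw'⟩ := h2
  rw [hH.dilation_mul] at hw'
  have hdW := hWL.homogeneous_W r hr w w.2
  have hdL := hWL.homogeneous_L r hr _ (ℓ w).2
  have h3 := congrArg (wPart X k) hw'
  rw [wPart_mul_of_mem hH hWL hdW hdL, wPart_mul_of_mem hH hWL w'.2 (ℓ w').2] at h3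
  have h4 := congrArg (horizontalPart X k) hw'
  rw [horizontalPart_mul_of_mem hH hWL hdW hdL,
    horizontalPart_mul_of_mem hH hWL w'.2 (ℓ w').2] at h4
  rw [h4]
  congr 2
  exact Subtype.ext h3

theorem relPoint_projW (φ : W → L) (a b : W) :
    relPoint X k φ a (projW hWL.isComplement ((basePoint φ a)⁻¹ * (b : G))) = b := by
  have h1 : (basePoint φ a)⁻¹ * (b : G) = (a : G) * ((φ a : G) * b * (φ a : G)⁻¹) * (φ a : G) := by
    unfold basePoint; group
  rw [relPoint_eq hH hWL, projW_eq hH hWL, h1, horizontalPart_mul_of_mem hH hWL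
    (W.mul_mem a.2 (conj_mem_W hH hWL _ b.2)) (φ a).2]
  group

theorem translatedMap_basePoint (φ : W → L) (a b : W) :
    translatedMap hWL.isComplement φ (basePoint φ a) b
      = (φ a)⁻¹ * φ (projW hWL.isComplement ((basePoint φ a)⁻¹ * (b : G))) := by
  have h1 : (basePoint φ a)⁻¹ * (b : G) = (a : G) * ((φ a : G) * b * (φ a : G)⁻¹) * (φ a : G) := by
    unfold basePoint; group
  have h2 : projL hWL.isComplement ((basePoint φ a)⁻¹ * (b : G)) = φ a := by
    refine Subtype.ext ?_
    rw [projL_eq hH hWL, h1, horizontalPart_mul_of_mem hH hWL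
      (W.mul_mem a.2 (conj_mem_W hH hWL _ b.2)) (φ a).2]
  unfold translatedMap
  rw [h2]

variable {N : G → ℝ} (hN : IsHomogeneousNorm X deg N) {d : G → G → ℝ}
  (hd : IsHomogeneousDistance X deg d)
include hN hd

omit hWL in
theorem exists_norm_equiv : ∃ C > 0, ∀ g, N g ≤ C * d 1 g ∧ d 1 g ≤ C * N g := by
  have hN1 : N 1 = 0 := (hN.eq_zero_iff 1).2 rfl
  have hNpos : ∀ g, g ≠ 1 → 0 < N g := fun g hg =>
    (hN.nonneg g).lt_of_ne fun h => hg ((hN.eq_zero_iff g).1 h.symm)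
  obtain ⟨C₁, hC₁, h₁⟩ := exists_abs_le_of_homogeneous hH (f := N) (p := 1)
    hd.continuous_one (fun g hg => hd.one_pos hg) ((hd.eq_zero_iff _ _).2 rfl)
    (fun r hr g => hd.one_dilation hH hr g) hN.continuous le_rfl
    fun r hr g => by rw [pow_one, hN.dilation r hr]
  obtain ⟨C₂, hC₂, h₂⟩ := exists_abs_le_of_homogeneous hH (f := d 1) (p := 1)
    hN.continuous hNpos hN1 (fun r hr g => hN.dilation r hr g) hd.continuous_one le_rfl
    fun r hr g => by rw [pow_one, hd.one_dilation hH hr]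
  refine ⟨C₁ + C₂, by positivity, fun g => ⟨?_, ?_⟩⟩
  · have := (le_abs_self _).trans (h₁ g)
    rw [pow_one] at this
    have h0 := mul_nonneg hC₂.le (hd.nonneg 1 g)
    linarith
  · have := (le_abs_self _).trans (h₂ g)
    rw [pow_one] at this
    have h0 := mul_nonneg hC₁.le (hN.nonneg g)
    linarith

variable {U : Set W} {φ : W → L} {a₀ : W} {A : Matrix (LIndex n k) (HIndex deg k) ℝ}

/-- The uniform estimate behind both the intrinsic and the uniform intrinsic differentiability. -/
theorem exists_norm_gradMap_inv_mul_le (hφ : ContinuousAt φ a₀)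
    (hj : ∀ j : Fin n, k ≤ (j : ℕ) → HasExpansionAt X deg hWL.isComplement U φ A a₀ j)
    {ε : ℝ} (hε : 0 < ε) :
    ∃ r > 0, ∀ a ∈ U, d a₀ a < r → ∀ b : W, d 1 b < r → b ≠ 1 →
      N (((gradMap hWL A b)⁻¹ * translatedMap hWL.isComplement φ (basePoint φ a) b : L) : G) / N b
        ≤ ε := by
  obtain ⟨C, hC, hCN⟩ := exists_norm_equiv hH hN hd
  obtain ⟨C₂, hC₂, hcoord⟩ := exists_dist_le_coordL hH hWL hd
  obtain ⟨r, hr, h⟩ := exists_norm_sub_partialGrad_le hH hWL hd hφ hj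
    (ε := ε / (C * C₂ * C)) (by positivity)
  refine ⟨r, hr, fun a ha had b hbr hb => ?_⟩
  have hbN : 0 < N (b : G) := (hN.nonneg _).lt_of_ne fun h0 =>
    hb (Subtype.ext ((hN.eq_zero_iff _).1 h0.symm))
  rw [div_le_iff₀ hbN]
  have h1 := h a ha had b hb hbr _ (relPoint_projW hH hWL φ a b)
  refine (hCN _).1.trans ?_
  have h2 := hcoord ((gradMap hWL A b)⁻¹ * translatedMap hWL.isComplement φ (basePoint φ a) b)
  rw [coordL_inv_mul hH hWL, coordL_gradMap, translatedMap_basePoint hH hWL,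
    coordL_inv_mul hH hWL] at h2
  rw [translatedMap_basePoint hH hWL]
  calc C * d 1 _ ≤ C * (C₂ * (ε / (C * C₂ * C) * (C * N b))) := by
        gcongr
        refine h2.trans ?_
        gcongr
        refine h1.trans ?_
        gcongr
        exact (hCN b).2
    _ = ε * N b := by field_simp

theorem isIntrinsicDifferentialAt_gradMap (ha₀ : a₀ ∈ U) (hφ : ContinuousAt φ a₀)
    (hj : ∀ j : Fin n, k ≤ (j : ℕ) → HasExpansionAt X deg hWL.isComplement U φ A a₀ j) :
    IsIntrinsicDifferentialAt X deg N hWL.isComplement U φ a₀ (gradMap hWL A) := by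
  refine ⟨isIntrinsicallyLinear_gradMap hH hWL A, fun ε hε => ?_⟩
  obtain ⟨C, hC, hCN⟩ := exists_norm_equiv hH hN hd
  obtain ⟨r, hr, h⟩ := exists_norm_gradMap_inv_mul_le hH hWL hN hd hφ hj hε
  refine ⟨r / C, by positivity, fun b _ hb0 hbr => ?_⟩
  refine h a₀ ha₀ (by rwa [(hd.eq_zero_iff _ _).2 rfl]) b ?_ ?_
  · refine (hCN b).2.trans_lt ?_
    rw [mul_comm]
    exact (lt_div_iff₀ hC).1 hbr
  · rintro rfl
    exact hb0.ne' ((hN.eq_zero_iff _).2 rfl)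

/-- Intrinsic differentials are unique. Two of them agree to first order at `1`, and both commute
with dilations. -/
theorem IsIntrinsicDifferentialAt.eq (hU : U ∈ 𝓝 a₀) (hφ : ContinuousAt φ a₀) {ℓ₁ ℓ₂ : W → L}
    (h₁ : IsIntrinsicDifferentialAt X deg N hWL.isComplement U φ a₀ ℓ₁)
    (h₂ : IsIntrinsicDifferentialAt X deg N hWL.isComplement U φ a₀ ℓ₂) : ℓ₁ = ℓ₂ := by
  obtain ⟨C, hC, hCN⟩ := exists_norm_equiv hH hN hd
  obtain ⟨r₀, hr₀, hnear⟩ := exists_mem_of_dist_relPoint_lt hH hWL hd hφ hU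
  funext w
  have hone : ∀ {ℓ : W → L}, IsIntrinsicallyLinear X deg ℓ → ℓ 1 = 1 := by
    intro ℓ hℓ
    have h3 := hℓ.map_dilation hH hWL two_pos 1
    have h4 : (⟨dilation X deg 2 ((1 : W) : G), hWL.homogeneous_W 2 two_pos _ (1 : W).2⟩ : W) = 1 :=
      Subtype.ext (hH.dilation_one 2)
    rw [h4] at h3
    have h5 := congrArg (d 1) h3
    rw [hd.one_dilation hH two_pos] at h5
    exact Subtype.ext ((hd.eq_zero_iff (1 : G) _).1 (by linarith)).symm
  by_cases hw : w = 1
  · rw [hw, hone h₁.1, hone h₂.1]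
  have hwG : (w : G) ≠ 1 := fun h => hw (Subtype.ext h)
  have hwN : 0 < N (w : G) := (hN.nonneg _).lt_of_ne fun h0 => hwG ((hN.eq_zero_iff _).1 h0.symm)
  have key : ∀ ε > 0, d 1 ((ℓ₁ w : G)⁻¹ * (ℓ₂ w : G)) ≤ ε := by
    intro ε hε
    obtain ⟨r₁, hr₁, h₁'⟩ := h₁.2 (ε / (2 * C * N (w : G))) (by positivity)
    obtain ⟨r₂, hr₂, h₂'⟩ := h₂.2 (ε / (2 * C * N (w : G))) (by positivity)
    -- A dilation factor bringing `w` into the neighbourhood of `1` where both estimates hold.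
    obtain ⟨s, hs, hs₀⟩ := exists_between
      (show 0 < min (r₀ / (C * N (w : G))) (min (r₁ / N (w : G)) (r₂ / N (w : G))) by positivity)
    simp only [lt_min_iff, lt_div_iff₀ hwN, lt_div_iff₀ (mul_pos hC hwN)] at hs₀
    obtain ⟨hs0, hs1, hs2⟩ := hs₀
    set b : W := ⟨dilation X deg s (w : G), hWL.homogeneous_W s hs w w.2⟩ with hb
    have hbN : N (b : G) = s * N (w : G) := hN.dilation s hs _
    have hbpos : 0 < N (b : G) := by rw [hbN]; positivity
    have hbU : b ∈ translatedDomain hWL.isComplement U (basePoint φ a₀) := by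
      refine hnear a₀ (by rwa [(hd.eq_zero_iff _ _).2 rfl]) _ ?_
      rw [relPoint_projW hH hWL]
      refine (hCN b).2.trans_lt ?_
      rw [hbN]
      linarith
    have e₁ := h₁' b hbU hbpos (by rwa [hbN])
    have e₂ := h₂' b hbU hbpos (by rwa [hbN])
    rw [div_le_iff₀ hbpos] at e₁ e₂
    set T := translatedMap hWL.isComplement φ (basePoint φ a₀) b
    have f₁ := (hCN (((ℓ₁ b)⁻¹ * T : L) : G)).2.trans (mul_le_mul_of_nonneg_left e₁ hC.le)
    have f₂ := (hCN (((ℓ₂ b)⁻¹ * T : L) : G)).2.trans (mul_le_mul_of_nonneg_left e₂ hC.le)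
    have g₁ : (ℓ₁ b : G)⁻¹ * (ℓ₂ b : G)
        = (((ℓ₁ b)⁻¹ * T : L) : G) * ((((ℓ₂ b)⁻¹ * T : L) : G))⁻¹ := by
      simp only [Subgroup.coe_mul, Subgroup.coe_inv]
      group
    have g₂ := hd.one_mul_le (((ℓ₁ b)⁻¹ * T : L) : G) ((((ℓ₂ b)⁻¹ * T : L) : G))⁻¹
    rw [← g₁, hd.one_inv, hb, h₁.1.map_dilation hH hWL hs, h₂.1.map_dilation hH hWL hs,
      ← hH.dilation_inv, ← hH.dilation_mul, hd.one_dilation hH hs] at g₂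
    rw [← hb] at g₂
    have g₃ : C * (ε / (2 * C * N (w : G)) * N (b : G)) = s * (ε / 2) := by
      rw [hbN]; field_simp
    have g₄ : s * d 1 ((ℓ₁ w : G)⁻¹ * (ℓ₂ w : G)) ≤ s * ε := by linarith
    exact le_of_mul_le_mul_left g₄ hs
  have h0 : d 1 ((ℓ₁ w : G)⁻¹ * (ℓ₂ w : G)) = 0 :=
    le_antisymm (le_of_forall_pos_le_add fun ε hε => by rw [zero_add]; exact key ε hε)
      (hd.nonneg _ _)
  exact Subtype.ext (inv_mul_eq_one.1 ((hd.eq_zero_iff _ _).1 h0).symm)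

end

end Differential

end

end Carnot

theorem mainTheorem4 {G : Type*} [NormedAddCommGroup G] [NormedSpace ℝ G] [FiniteDimensional ℝ G]
    [Group G] [LieGroup 𝓘(ℝ, G) ((⊤ : ℕ∞) : WithTop ℕ∞) G]
    {s : ℕ} {V : ℕ → Submodule ℝ G} (hG : Carnot.IsCarnotGroup s V)
    {n : ℕ} {X : Module.Basis (Fin n) ℝ G} {deg : Fin n → ℕ}
    (hX : Carnot.IsAdaptedBasis s V X deg)
    {N : G → ℝ} (hN : Carnot.IsHomogeneousNorm X deg N)
    {d : G → G → ℝ} (hd : Carnot.IsHomogeneousDistance X deg d)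
    {k : ℕ} {W L : Subgroup G} (hWL : Carnot.IsHorizontalSplitting X deg k W L)
    {U : Set W} (hU : IsOpen U)
    {φ : W → L} (hφ : ContinuousOn φ U)
    (hvert : Carnot.IsVerticallyBroadStarHolder X deg k hWL.isComplement U φ)
    {ω : W → Matrix (Carnot.LIndex n k) (Carnot.HIndex deg k) ℝ} (hω : ContinuousOn ω U)
    (hbroad : Carnot.IsBroadStar X deg d k hWL.isComplement U φ ω) :
    Carnot.IsUIDOn X deg N d hWL.isComplement U φ ∧
      ∀ a ∈ U, Carnot.HasIntrinsicGradientAt X deg N k hWL.isComplement U φ a (ω a) := by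
  have hH := hG.isHomogeneousGroup hX
  have hφ₀ : ∀ a₀ ∈ U, ContinuousAt φ a₀ := fun a₀ ha₀ => hφ.continuousAt (hU.mem_nhds ha₀)
  have hexp : ∀ a₀ ∈ U, ∀ j : Fin n, k ≤ (j : ℕ) →
      Carnot.HasExpansionAt X deg hWL.isComplement U φ (ω a₀) a₀ j := by
    intro a₀ ha₀ j hkj
    rcases (hH.one_le_deg j).eq_or_lt with hj | hj
    · exact hbroad.hasExpansionAt hH hWL hd hU hφ hω ha₀ hkj hj.symm
    · exact hvert.hasExpansionAt ha₀ hj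
  have hdiff : ∀ a₀ ∈ U, Carnot.IsIntrinsicDifferentialAt X deg N hWL.isComplement U φ a₀
      (Carnot.gradMap hWL (ω a₀)) := fun a₀ ha₀ =>
    Carnot.isIntrinsicDifferentialAt_gradMap hH hWL hN hd ha₀ (hφ₀ a₀ ha₀) (hexp a₀ ha₀)
  refine ⟨fun a₀ ha₀ => ⟨_, hdiff a₀ ha₀, fun ε hε => ?_⟩, fun a₀ ha₀ => ⟨⟨_, hdiff a₀ ha₀⟩, ?_⟩⟩
  · obtain ⟨r, hr, h⟩ := Carnot.exists_norm_gradMap_inv_mul_le hH hWL hN hd (hφ₀ a₀ ha₀)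
      (hexp a₀ ha₀) hε
    exact ⟨r, hr, fun a ha had b _ hbr hb => h a ha had b hbr hb⟩
  · intro ℓ hℓ y w hw
    rw [hℓ.eq hH hWL hN hd (hU.mem_nhds ha₀) (hφ₀ a₀ ha₀) (hdiff a₀ ha₀)]
    have hy : (fun j : Carnot.HIndex deg k => X.repr (w : G) (j : Fin n)) = y := by
      funext j
      rw [hw]
      simp only [map_sum, map_smul, Module.Basis.repr_self, Finsupp.coe_finsetSum,
        Finset.sum_apply, Finsupp.smul_apply, smul_eq_mul, Finsupp.single_apply]
      rw [Finset.sum_eq_single j]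
      · simp
      · intro l _ hl
        rw [if_neg fun h => hl (Subtype.ext h), mul_zero]
      · simp
    rw [← hy]
    rfl
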